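/- Let $M=(m_{ij})_{i,j\in I}$ be a Coxeter matrix over a finite set $I$. Let $\mathrm{Br}^+(M)$ be its Artin monoid, generated by $T_i$, $i\in I$, subject to $T_iT_jT_i\cdots=T_jT_iT_j\cdots$ ($m_{ij}$ factors on each side) for $i\ne j$ with $m_{ij}<\infty$. Let $W(M)$ be its Coxeter group, with simple generators $s_i$, and for $w\in W(M)$ let $T_w=T_{i_1}\cdots T_{i_k}$ for any reduced expression $w=s_{i_1}\cdots s_{i_k}$. Call $J\subset I$ of finite type if $W_J(M)=\langle s_j: j\in J\rangle$ is finite; then $w_\circ^J$ denotes its longest element, and for $J\subset K$ with $K$ of finite type put $w_{J;K}=w_\circ^Jw_\circ^K$. If $W(M)$ is finite, the elements $T_{w_{J;I}}$, $J\subset I$, of $\mathrm{Br}^+(M)$ are called parabolic. For a homomorphism of monoids $\Phi:\mathrm{Br}^+(M')\to\mathrm{Br}^+(M)$ (with generators $T'_i$, $i\in I'$, in the domain) and $K'\subset I'$, let $[\Phi](K')\subset I$ be the union of the supports of the $\Phi(T'_i)$, $i\in K'$, where the support of an element is the set of all $i$ such that $T_i$ occurs in a word representing it. $\Phi$ is called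 strict parabolic if for every maximal subset $K'\subset I'$ of finite type, the set $K=[\Phi](K')$ is of finite type and for each $J'\subset K'$ there is $J\subset K$ with $\Phi(T'_{w_{J';K'}})=T_{w_{J;K}}$. Number the nodes of $B_n$, $n\ge 2$, by $1,\dots,n$ along the diagram so that $m_{n-1,n}=4$, and write $[a,b]=\{i\in\mathbb Z: a\le i\le b\}$. (a) For any $2\le m\le n$, the assignments $$T'_1\mapsto (T_mT_{m+1}\cdots T_{n-1}T_nT_{n-1}\cdots T_m)(T_{m-2}T_{m-4}\cdots),\qquad T'_2\mapsto T_{m-1}T_{m-3}\cdots$$ (only positive indices occur) define a strict parabolic homomorphism $\mathrm{Br}^+(I_2(2m))\to\mathrm{Br}^+(B_n)$. (b) For any $2\le m\le n$, the assignments $$T'_i\mapsto T_i,\quad i\in[1,m-1],\qquad T'_m\mapsto T_mT_{m+1}\cdots T_{n-1}T_nT_{n-1}\cdots T_m$$ define a strict parabolic homomorphism $\mathrm{Br}^+(B_m)\to\mathrm{Br}^+(B_n)$. (c) For all $m,n\ge 2$, the assignments $$T'_i\mapsto T_{w_{[(i-1)m+1,im-1]\cup[im+1,(i+1)m-1];\,[(i-1)m+1,(i+1)m-1]}},\quad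 i\in[1,n-1],\qquad T'_n\mapsto T_{w_{[(n-1)m+1,nm-1];\,[(n-1)m+1,nm]}}$$ define a strict parabolic homomorphism $\mathrm{Br}^+(B_n)\to\mathrm{Br}^+(B_{mn})$. In each case the Coxeter groups are finite, and the homomorphism maps every parabolic element of its domain to a parabolic element of its codomain. -/

import Mathlib

noncomputable section

namespace Artin

/-- The alternating product `x y x y ⋯` with `m` factors, starting with `x`. -/
def brd {A : Type*} [Monoid A] (x y : A) (m : ℕ) : A := (x * y) ^ (m / 2) * x ^ (m % 2)

/-- The defining relations of the Artin monoid: `T_i T_j T_i ⋯ = T_j T_i T_j ⋯` with `m_{ij}`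
factors on both sides, for `i ≠ j` with `m_{ij} < ∞`.
(In a `CoxeterMatrix`, the entry `∞` is encoded by `0`.) -/
def braidRel {B : Type*} (M : CoxeterMatrix B) (a b : FreeMonoid B) : Prop :=
  ∃ i j : B, i ≠ j ∧ M i j ≠ 0 ∧
    a = brd (FreeMonoid.of i) (FreeMonoid.of j) (M i j) ∧
    b = brd (FreeMonoid.of j) (FreeMonoid.of i) (M i j)

/-- The Artin monoid `Br⁺(M)`. -/
abbrev ArtinMonoid {B : Type*} (M : CoxeterMatrix B) : Type _ := PresentedMonoid (braidRel M)

/-- The generator `T_i` of `Br⁺(M)`. -/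
def gen {B : Type*} (M : CoxeterMatrix B) (i : B) : ArtinMonoid M :=
  PresentedMonoid.of (braidRel M) i

theorem map_brd {A C : Type*} [Monoid A] [Monoid C] (f : A →* C) (x y : A) (m : ℕ) :
    f (brd x y m) = brd (f x) (f y) m := by
  simp [brd]

theorem mul_swap_pow {A : Type*} [Monoid A] (x y : A) (k : ℕ) :
    x * (y * x) ^ k = (x * y) ^ k * x := by
  induction k with
  | zero => simp
  | succ k ih => rw [pow_succ, ← mul_assoc, ih, pow_succ]; simp only [mul_assoc]

theorem simple_brd {B : Type*} (M : CoxeterMatrix B) (i j : B) :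
    brd (M.simple i) (M.simple j) (M i j) = brd (M.simple j) (M.simple i) (M i j) := by
  have h := M.toCoxeterSystem.wordProd_braidWord_eq j i
  rw [CoxeterSystem.braidWord, CoxeterSystem.braidWord,
    CoxeterSystem.prod_alternatingWord_eq_mul_pow,
    CoxeterSystem.prod_alternatingWord_eq_mul_pow, M.symmetric j i] at h
  simp only [CoxeterMatrix.toCoxeterSystem_simple] at h
  rcases Nat.mod_two_eq_zero_or_one (M i j) with h2 | h2
  · have he : Even (M i j) := Nat.even_iff.2 h2
    simp only [he, if_true, one_mul] at h
    simp [brd, h2, h]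
  · have he : ¬ Even (M i j) := by rw [Nat.even_iff]; omega
    simp only [he, if_false, mul_swap_pow] at h
    simp [brd, h2, h]

/-- The canonical projection `π_M : Br⁺(M) → W(M)`, `T_i ↦ s_i`, onto the Coxeter group. -/
def proj {B : Type*} (M : CoxeterMatrix B) : ArtinMonoid M →* M.Group :=
  PresentedMonoid.lift M.simple (by
    rintro a b ⟨i, j, -, -, rfl, rfl⟩
    simp only [map_brd, FreeMonoid.lift_eval_of]
    exact simple_brd M i j)

/-- The length homomorphism `ℓ : Br⁺(M) → (ℕ, +)`, `ℓ(T_i) = 1`: the number of letters of any word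
in the generators that represents the given element. -/
def lengthHom {B : Type*} (M : CoxeterMatrix B) : ArtinMonoid M →* Multiplicative ℕ :=
  PresentedMonoid.lift (fun _ => Multiplicative.ofAdd 1) (by
    rintro a b ⟨i, j, -, -, rfl, rfl⟩
    simp only [map_brd, FreeMonoid.lift_eval_of])

/-- The length of an element of `Br⁺(M)`. -/
def length {B : Type*} (M : CoxeterMatrix B) (X : ArtinMonoid M) : ℕ :=
  Multiplicative.toAdd (lengthHom M X)

/-- `X` is square free if the length of its image in the Coxeter group is the length of `X`. -/
def SquareFree {B : Type*} (M : CoxeterMatrix B) (X : ArtinMonoid M) : Prop :=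
  M.toCoxeterSystem.length (proj M X) = length M X

theorem exists_squareFree {B : Type*} (M : CoxeterMatrix B) (w : M.Group) :
    ∃ X : ArtinMonoid M, SquareFree M X ∧ proj M X = w := by
  obtain ⟨ω, hω, rfl⟩ := M.toCoxeterSystem.exists_isReduced w
  have hp : proj M (ω.map (gen M)).prod = M.toCoxeterSystem.wordProd ω := by
    clear hω
    induction ω with
    | nil => simp
    | cons i ω ih =>
      rw [List.map_cons, List.prod_cons, map_mul, ih, CoxeterSystem.wordProd_cons,
        CoxeterMatrix.toCoxeterSystem_simple]
      rfl
  have hl : length M (ω.map (gen M)).prod = ω.length := by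
    clear hω hp
    induction ω with
    | nil => simp [length]
    | cons i ω ih =>
      have h1 : lengthHom M (gen M i) = Multiplicative.ofAdd 1 := rfl
      unfold length at ih ⊢
      rw [List.map_cons, List.prod_cons, map_mul, toAdd_mul, ih, h1, List.length_cons, toAdd_ofAdd,
        add_comm]
  exact ⟨_, by rw [SquareFree, hp, hl, hω.eq], hp⟩

/-- `T_w`, the (unique, by a theorem of Tits) square free element of `Br⁺(M)` over `w`. -/
def lift {B : Type*} (M : CoxeterMatrix B) (w : M.Group) : ArtinMonoid M :=
  Classical.choose (exists_squareFree M w)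

/-- The parabolic subgroup `W_J(M)` of the Coxeter group `W(M)`. -/
def parabolicSubgroup {B : Type*} (M : CoxeterMatrix B) (J : Set B) : Subgroup M.Group :=
  Subgroup.closure (M.simple '' J)

/-- `J` is of finite type if `W_J(M)` is finite. -/
def FiniteType {B : Type*} (M : CoxeterMatrix B) (J : Set B) : Prop :=
  (parabolicSubgroup M J : Set M.Group).Finite

theorem exists_longest {B : Type*} (M : CoxeterMatrix B) (J : Set B) (hJ : FiniteType M J) :
    ∃ w ∈ parabolicSubgroup M J, ∀ u ∈ parabolicSubgroup M J,
      M.toCoxeterSystem.length u ≤ M.toCoxeterSystem.length w := by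
  obtain ⟨w, hw, h⟩ := Set.exists_max_image _ M.toCoxeterSystem.length hJ
    ⟨1, (parabolicSubgroup M J).one_mem⟩
  exact ⟨w, hw, h⟩

open scoped Classical in
/-- The (unique) longest element `w_∘^J` of `W_J(M)`, for `J` of finite type
(and `1` by convention for the other `J`). -/
def longest {B : Type*} (M : CoxeterMatrix B) (J : Set B) : M.Group :=
  if hJ : FiniteType M J then Classical.choose (exists_longest M J hJ) else 1

/-- The element `T_{w_{J;K}}` of `Br⁺(M)`, where `w_{J;K} = w_∘^J w_∘^K`. -/
def parabolicElt {B : Type*} (M : CoxeterMatrix B) (J K : Set B) : ArtinMonoid M :=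
  lift M (longest M J * longest M K)

/-- The parabolic elements `T_{w_{J;I}}`, `J ⊆ I`, of an Artin monoid of finite type over `I`. -/
def IsParabolicElt {B : Type*} (M : CoxeterMatrix B) (X : ArtinMonoid M) : Prop :=
  FiniteType M Set.univ ∧ ∃ J : Set B, X = parabolicElt M J Set.univ

/-- The support of `X`: the intersection of all `J` such that `X` lies in the submonoid
generated by the `T_j`, `j ∈ J`. -/
def supp {B : Type*} (M : CoxeterMatrix B) (X : ArtinMonoid M) : Set B :=
  ⋂₀ {J : Set B | X ∈ Submonoid.closure (gen M '' J)}

/-- `[Φ](J)`, the union of the supports of the `Φ(T_j)`, `j ∈ J`. -/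
def homSupp {B' B : Type*} {M' : CoxeterMatrix B'} {M : CoxeterMatrix B}
    (Φ : ArtinMonoid M' →* ArtinMonoid M) (J : Set B') : Set B :=
  ⋃ j ∈ J, supp M (Φ (gen M' j))

/-- `Φ` is strict parabolic: for every maximal `K'` of finite type, `K = [Φ](K')` is of finite type
and `Φ` maps every `T_{w_{J';K'}}`, `J' ⊆ K'`, to some `T_{w_{J;K}}`, `J ⊆ K`. -/
def StrictParabolic {B' B : Type*} {M' : CoxeterMatrix B'} {M : CoxeterMatrix B}
    (Φ : ArtinMonoid M' →* ArtinMonoid M) : Prop :=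
  ∀ K' : Set B', Maximal (FiniteType M') K' →
    FiniteType M (homSupp Φ K') ∧
    ∀ J' ⊆ K', ∃ J ⊆ homSupp Φ K',
      Φ (parabolicElt M' J' K') = parabolicElt M J (homSupp Φ K')

/-- `Φ` maps parabolic elements to parabolic elements (for Artin monoids of finite type). -/
def MapsParabolicElts {B' B : Type*} {M' : CoxeterMatrix B'} {M : CoxeterMatrix B}
    (Φ : ArtinMonoid M' →* ArtinMonoid M) : Prop :=
  FiniteType M' Set.univ ∧ ∀ X, IsParabolicElt M' X → IsParabolicElt M (Φ X)

/-- The Coxeter matrix `I₂(2m)`; Mathlib's `CoxeterMatrix.I k` is of type `I₂(k + 2)`. -/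
abbrev matI (m : ℕ) : CoxeterMatrix (Fin 2) := CoxeterMatrix.I (2 * m - 2)

theorem matI_zero_one (m : ℕ) (hm : 1 ≤ m) : matI m 0 1 = 2 * m := by
  simp [matI, CoxeterMatrix.I]
  omega

/-- The Coxeter matrix `B_n`. Node `k` of the diagram, `1 ≤ k ≤ n`, is `k - 1` in `Fin n`, and the
edge with label `4` joins the nodes `n - 1` and `n`. -/
abbrev matB (n : ℕ) : CoxeterMatrix (Fin n) := CoxeterMatrix.B n

/-- The generator `T_k` of `Br⁺(B_n)` with the numbering `1, …, n` of the nodes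
(and `1` by convention when `k` is not in `[1, n]`). -/
def genB (n k : ℕ) : ArtinMonoid (matB n) :=
  if h : 1 ≤ k ∧ k ≤ n then gen (matB n) ⟨k - 1, by omega⟩ else 1

/-- The interval `[a, b]` of nodes of `B_n`, with the numbering `1, …, n` of the nodes. -/
def intervalB (n a b : ℕ) : Set (Fin n) := {i | a ≤ (i : ℕ) + 1 ∧ (i : ℕ) + 1 ≤ b}

/-- `T_m T_{m+1} ⋯ T_{n-1} T_n T_{n-1} ⋯ T_{m+1} T_m` in `Br⁺(B_n)`. -/
def palindromeB (n m : ℕ) : ArtinMonoid (matB n) :=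
  ((List.Ico m n).map (genB n)).prod * genB n n * ((List.Ico m n).reverse.map (genB n)).prod

/-- `T_k T_{k-2} T_{k-4} ⋯` in `Br⁺(B_n)`, the indices being positive. -/
def stepDownB (n : ℕ) : ℕ → ArtinMonoid (matB n)
  | 0 => 1
  | 1 => genB n 1
  | k + 2 => genB n (k + 2) * stepDownB n k

end Artin

end

/-!
The Coxeter group `W(B_n)` acts on integer sequences by signed permutations of the first `n`
coordinates. For a sequence `y` that is dominant (`y_1 > ⋯ > y_n > 0`), the word combinatorics of
the group can be read off from `w y`: a simple reflection lengthens `w` exactly when `w y` is on its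
positive side. This needs only a check in dihedral subgroups (`Dominance.pos_alt`) and an induction
in which one splits off a maximal alternating prefix (`Dominance.pos_or_exists_altWord`). It gives
simple transitivity on chambers (`Dominance.eq_one_of_dom`), additivity of lengths in
`W_J · (shortest coset representative)` (`Dominance.length_mul_of_dom`), the theorem of Matsumoto
and Tits that `T_w` is well defined (`Dominance.wordGen_eq_of_isReduced`), finiteness of `W(B_n)`
and a characterization of the longest elements (`eq_longest`).

Consequently a homomorphism `φ` of Coxeter groups lifts to the Artin monoids, with `T_w ↦ T_{φ(w)}`,
as soon as lengths add up along reduced words after applying `φ` (`Dominance.exists_hom`).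

For the two families from type `B` to type `B`, the homomorphism `φ` comes from a map `E` of
sequences (`BlockEmbedding`): append a fixed small tail, or replace every coordinate by a block of
`m` coordinates. Equivariance of `E` and regularity of `E ρ` yield the Coxeter relations, and the
fact that `E` preserves dominance yields additivity of lengths. If `L` is the set of nodes inside
the blocks and `θ i` the set of nodes that correspond to the node `i`, then `T_{w_{J';I'}}` is
mapped to `T_{w_{J;I}}` with `J = L ∪ θ(J')`, because `-E (-w ρ)` is `J`-antidominant when `w` is
the longest element of `W_{J'}`.

For the dihedral groups it suffices to treat `I₂(2m) → B_m` and to compose. There the alternating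
products of `X = T_m T_{m-2} ⋯` and `Y = T_{m-1} T_{m-3} ⋯` act on `ρ` like a billiard
(`billiard`, `repB_halfB_billiard`): coordinates move with unit speed and are reflected at both
ends. The explicit formula shows that each of the `2 m` steps is ascending and that the final
position is `-ρ`, so that both alternating products with `2 m` factors are `T_{w_∘}`.

Supports are detected by the partial sums of the coordinates: that of the first `k` coordinates is
changed only by the `k`-th simple reflection (`sum_reflB`).
-/

noncomputable section

namespace Artin

/-! ### Words in the generators -/

section Words

variable {B : Type*} (M : CoxeterMatrix B)

theorem brd_succ {A : Type*} [Monoid A] (x y : A) (m : ℕ) :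
    brd x y (m + 1) = x * brd y x m := by
  obtain ⟨k, rfl | rfl⟩ := Nat.even_or_odd' m
  · have h1 : (2 * k + 1) / 2 = k := by omega
    have h2 : (2 * k + 1) % 2 = 1 := by omega
    simp [brd, h1, h2, mul_swap_pow]
  · have h1 : (2 * k + 1 + 1) / 2 = k + 1 := by omega
    have h2 : (2 * k + 1 + 1) % 2 = 0 := by omega
    have h3 : (2 * k + 1) / 2 = k := by omega
    have h4 : (2 * k + 1) % 2 = 1 := by omega
    simp only [brd, h1, h2, h3, h4, pow_zero, mul_one, pow_succ]
    rw [← mul_assoc x, mul_swap_pow, one_mul, mul_assoc]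

/-- The alternating word `i j i j ⋯` with `p` letters, starting with `i`. -/
def altWord (i j : B) : ℕ → List B
  | 0 => []
  | p + 1 => i :: altWord j i p

@[simp] theorem length_altWord (i j : B) (p : ℕ) : (altWord i j p).length = p := by
  induction p generalizing i j with
  | zero => rfl
  | succ p ih => simp [altWord, ih]

theorem prod_map_altWord {A : Type*} [Monoid A] (x : B → A) (i j : B) (p : ℕ) :
    ((altWord i j p).map x).prod = brd (x i) (x j) p := by
  induction p generalizing i j with
  | zero => simp [altWord, brd]
  | succ p ih => rw [altWord, List.map_cons, List.prod_cons, ih, brd_succ]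

theorem altWord_add (i j : B) (p q : ℕ) :
    altWord i j (p + q) = altWord i j p ++ if Even p then altWord i j q else altWord j i q := by
  induction p generalizing i j with
  | zero => simp [altWord]
  | succ p ih =>
    rw [Nat.add_right_comm, altWord, ih j i, altWord, List.cons_append]
    by_cases hp : Even p <;> simp [hp, Nat.even_add_one]

/-- The element of the Artin monoid represented by a word. -/
def wordGen (ω : List B) : ArtinMonoid M := (ω.map (gen M)).prod

@[simp] theorem wordGen_nil : wordGen M [] = 1 := rfl

theorem wordGen_cons (i : B) (ω : List B) : wordGen M (i :: ω) = gen M i * wordGen M ω := by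
  simp [wordGen]

theorem wordGen_append (ω ω' : List B) :
    wordGen M (ω ++ ω') = wordGen M ω * wordGen M ω' := by
  simp [wordGen]

theorem wordGen_surjective : Function.Surjective (wordGen M) := by
  intro X
  have h : X ∈ Submonoid.closure (Set.range (PresentedMonoid.of (braidRel M))) := by
    rw [PresentedMonoid.closure_range_of]; trivial
  induction h using Submonoid.closure_induction with
  | mem x hx => obtain ⟨i, rfl⟩ := hx; exact ⟨[i], by simp [wordGen, gen]⟩
  | one => exact ⟨[], rfl⟩
  | mul x y _ _ hx hy =>
    obtain ⟨a, rfl⟩ := hx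
    obtain ⟨b, rfl⟩ := hy
    exact ⟨a ++ b, wordGen_append M a b⟩

@[simp] theorem proj_gen (i : B) : proj M (gen M i) = M.simple i := rfl

@[simp] theorem proj_wordGen (ω : List B) :
    proj M (wordGen M ω) = M.toCoxeterSystem.wordProd ω := by
  induction ω with
  | nil => simp
  | cons i ω ih =>
    rw [wordGen_cons, map_mul, ih, CoxeterSystem.wordProd_cons]; rfl

theorem length_mul (X Y : ArtinMonoid M) : length M (X * Y) = length M X + length M Y := by
  simp [length]

@[simp] theorem length_gen (i : B) : length M (gen M i) = 1 := rfl

@[simp] theorem length_one : length M 1 = 0 := by simp [length]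

@[simp] theorem length_wordGen (ω : List B) : length M (wordGen M ω) = ω.length := by
  induction ω with
  | nil => simp
  | cons i ω ih => rw [wordGen_cons, length_mul, ih, length_gen, List.length_cons, add_comm]

theorem squareFree_wordGen {ω : List B} :
    SquareFree M (wordGen M ω) ↔ M.toCoxeterSystem.IsReduced ω := by
  rw [SquareFree, proj_wordGen, length_wordGen, CoxeterSystem.IsReduced]

theorem squareFree_lift (w : M.Group) : SquareFree M (lift M w) :=
  (Classical.choose_spec (exists_squareFree M w)).1

@[simp] theorem proj_lift (w : M.Group) : proj M (lift M w) = w :=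
  (Classical.choose_spec (exists_squareFree M w)).2

theorem wordGen_braid {i j : B} (hij : i ≠ j) (hm : M i j ≠ 0) :
    wordGen M (altWord i j (M i j)) = wordGen M (altWord j i (M i j)) := by
  have h := PresentedMonoid.mk_eq_mk_of_rel (rels := braidRel M)
    (x := brd (FreeMonoid.of i) (FreeMonoid.of j) (M i j))
    (y := brd (FreeMonoid.of j) (FreeMonoid.of i) (M i j)) ⟨i, j, hij, hm, rfl, rfl⟩
  rw [map_brd, map_brd] at h
  rw [wordGen, wordGen, prod_map_altWord, prod_map_altWord]
  exact h

theorem wordProd_braid (i j : B) :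
    M.toCoxeterSystem.wordProd (altWord i j (M i j)) =
      M.toCoxeterSystem.wordProd (altWord j i (M i j)) := by
  rw [CoxeterSystem.wordProd, CoxeterSystem.wordProd, prod_map_altWord, prod_map_altWord]
  exact simple_brd M i j

theorem length_mod_two_eq {ω ω' : List B}
    (h : M.toCoxeterSystem.wordProd ω = M.toCoxeterSystem.wordProd ω') :
    ω.length % 2 = ω'.length % 2 := by
  have key : ∀ ω : List B,
      M.toCoxeterSystem.length (M.toCoxeterSystem.wordProd ω) % 2 = ω.length % 2 := by
    intro ω
    induction ω with
    | nil => simp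
    | cons i ω ih =>
      rw [CoxeterSystem.wordProd_cons, CoxeterSystem.length_mul_mod_two,
        CoxeterSystem.length_simple, List.length_cons]
      omega
  rw [← key ω, ← key ω', h]

end Words

/-! ### Words of minimal length in a parabolic subgroup -/

section MinimalWords

variable {B : Type*} {M : CoxeterMatrix B} {J : Set B}

/-- `ω` is a word in the letters of `J` of minimal length among those with the same product. -/
def MinWord (M : CoxeterMatrix B) (J : Set B) (ω : List B) : Prop :=
  (∀ i ∈ ω, i ∈ J) ∧ ∀ ω' : List B, (∀ i ∈ ω', i ∈ J) →
    M.toCoxeterSystem.wordProd ω' = M.toCoxeterSystem.wordProd ω → ω.length ≤ ω'.length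

theorem simple_mem_parabolicSubgroup {i : B} (hi : i ∈ J) :
    M.simple i ∈ parabolicSubgroup M J :=
  Subgroup.subset_closure ⟨i, hi, rfl⟩

theorem parabolicSubgroup_mono {J K : Set B} (h : J ⊆ K) :
    parabolicSubgroup M J ≤ parabolicSubgroup M K :=
  Subgroup.closure_mono (Set.image_mono h)

theorem exists_word_of_mem_parabolicSubgroup {w : M.Group} (hw : w ∈ parabolicSubgroup M J) :
    ∃ ω : List B, (∀ i ∈ ω, i ∈ J) ∧ M.toCoxeterSystem.wordProd ω = w := by
  induction hw using Subgroup.closure_induction with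
  | mem x hx =>
    obtain ⟨i, hi, rfl⟩ := hx
    exact ⟨[i], by simpa using hi, by simp⟩
  | one => exact ⟨[], by simp, by simp⟩
  | mul x y _ _ hx hy =>
    obtain ⟨a, ha, rfl⟩ := hx
    obtain ⟨b, hb, rfl⟩ := hy
    refine ⟨a ++ b, ?_, by rw [CoxeterSystem.wordProd_append]⟩
    intro i hi
    rcases List.mem_append.1 hi with h | h
    exacts [ha i h, hb i h]
  | inv x _ hx =>
    obtain ⟨a, ha, rfl⟩ := hx
    exact ⟨a.reverse, by simpa using ha, by rw [CoxeterSystem.wordProd_reverse]⟩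

theorem exists_minWord {ω : List B} (h : ∀ i ∈ ω, i ∈ J) :
    ∃ ω', MinWord M J ω' ∧
      M.toCoxeterSystem.wordProd ω' = M.toCoxeterSystem.wordProd ω ∧ ω'.length ≤ ω.length := by
  induction hn : ω.length using Nat.strong_induction_on generalizing ω with
  | _ n ih =>
    by_cases hm : MinWord M J ω
    · exact ⟨ω, hm, rfl, hn.le⟩
    · have : ∃ ω' : List B, (∀ i ∈ ω', i ∈ J) ∧
          M.toCoxeterSystem.wordProd ω' = M.toCoxeterSystem.wordProd ω ∧
          ω'.length < ω.length := by
        by_contra hcon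
        push Not at hcon
        exact hm ⟨h, hcon⟩
      obtain ⟨ω', h1, h2, h3⟩ := this
      obtain ⟨ω'', h4, h5, h6⟩ := ih ω'.length (hn ▸ h3) h1 rfl
      exact ⟨ω'', h4, h5.trans h2, by omega⟩

theorem exists_minWord_of_mem {w : M.Group} (hw : w ∈ parabolicSubgroup M J) :
    ∃ ω, MinWord M J ω ∧ M.toCoxeterSystem.wordProd ω = w := by
  obtain ⟨ω, h, rfl⟩ := exists_word_of_mem_parabolicSubgroup hw
  obtain ⟨ω', h1, h2, -⟩ := exists_minWord (M := M) h
  exact ⟨ω', h1, h2⟩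

theorem MinWord.of_append {a b : List B} (h : MinWord M J (a ++ b)) : MinWord M J b := by
  refine ⟨fun i hi => h.1 i (by simp [hi]), fun ω' h1 h2 => ?_⟩
  have := h.2 (a ++ ω') (fun i hi => ?_) (by simp only [CoxeterSystem.wordProd_append, h2])
  · simp only [List.length_append] at this; omega
  · rcases List.mem_append.1 hi with h' | h'
    exacts [h.1 i (by simp [h']), h1 i h']

theorem MinWord.tail {i : B} {ω : List B} (h : MinWord M J (i :: ω)) : MinWord M J ω :=
  MinWord.of_append (a := [i]) h

theorem MinWord.congr {ω ω' : List B} (h : MinWord M J ω) (h1 : ∀ i ∈ ω', i ∈ J)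
    (h2 : M.toCoxeterSystem.wordProd ω' = M.toCoxeterSystem.wordProd ω)
    (h3 : ω'.length = ω.length) : MinWord M J ω' :=
  ⟨h1, fun a ha hw => h3 ▸ h.2 a ha (hw.trans h2)⟩

theorem not_minWord_cons_self {i : B} {ω : List B} : ¬ MinWord M J (i :: i :: ω) := by
  intro h
  have := h.2 ω (fun k hk => h.1 k (by simp [hk])) (by
    rw [CoxeterSystem.wordProd_cons, CoxeterSystem.wordProd_cons,
      CoxeterSystem.simple_mul_simple_cancel_left])
  simp at this

/-- If a minimal word cannot be extended by the letter `i` on the left, then its product is also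
that of a minimal word starting with `i`. -/
theorem MinWord.exists_cons {i : B} {ω : List B} (hi : i ∈ J) (h : MinWord M J ω)
    (hn : ¬ MinWord M J (i :: ω)) :
    ∃ ω', MinWord M J (i :: ω') ∧
      M.toCoxeterSystem.wordProd (i :: ω') = M.toCoxeterSystem.wordProd ω ∧
      (i :: ω').length = ω.length := by
  have hmem : ∀ k ∈ i :: ω, k ∈ J := by
    intro k hk
    rcases List.mem_cons.1 hk with rfl | hk
    exacts [hi, h.1 k hk]
  obtain ⟨a, ha1, ha2, ha3⟩ := exists_minWord (M := M) hmem
  have hlen : a.length ≠ (i :: ω).length := fun he => hn (ha1.congr hmem ha2.symm he.symm)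
  have hpar := length_mod_two_eq M ha2
  simp only [List.length_cons] at hlen ha3 hpar
  have hmem' : ∀ k ∈ i :: a, k ∈ J := by
    intro k hk
    rcases List.mem_cons.1 hk with rfl | hk
    exacts [hi, ha1.1 k hk]
  have hw : M.toCoxeterSystem.wordProd (i :: a) = M.toCoxeterSystem.wordProd ω := by
    rw [CoxeterSystem.wordProd_cons, ha2, CoxeterSystem.wordProd_cons,
      CoxeterSystem.simple_mul_simple_cancel_left]
  have h1 := h.2 _ hmem' hw
  have hl : (i :: a).length = ω.length := by
    simp only [List.length_cons] at h1 ⊢; omega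
  exact ⟨a, h.congr hmem' hw hl, hw, hl⟩

theorem minWord_univ {ω : List B} :
    MinWord M Set.univ ω ↔ M.toCoxeterSystem.IsReduced ω := by
  constructor
  · intro h
    obtain ⟨a, ha, hw⟩ := M.toCoxeterSystem.exists_isReduced (M.toCoxeterSystem.wordProd ω)
    have h1 := h.2 a (by simp) hw.symm
    have h2 := M.toCoxeterSystem.length_wordProd_le ω
    have h3 := ha.eq
    rw [← hw] at h3
    rw [CoxeterSystem.IsReduced]
    omega
  · intro h
    refine ⟨by simp, fun a _ hw => ?_⟩
    have := M.toCoxeterSystem.length_wordProd_le a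
    rw [hw, h.eq] at this
    exact this

end MinimalWords

/-! ### Dominance for an action of a Coxeter group -/

/-- An action of the Coxeter group on `Y` with, for each simple reflection `s_i`, an abstract open
half space `pos i` of `Y` such that `s_i` maps this half space into its complement, and such that
the fundamental chamber of every dihedral subgroup `⟨s_i, s_j⟩` behaves as expected: a shorter
alternating word starting with `s_i` keeps the chamber `pos i ∩ pos j` on the positive side
of `s_j`. -/
structure Dominance {B : Type*} (M : CoxeterMatrix B) (Y : Type*) where
  /-- The action of the Coxeter group. -/
  rep : M.Group →* Equiv.Perm Y
  /-- The half space attached to a simple reflection. -/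
  pos : B → Y → Prop
  pos_simple : ∀ i y, pos i y → ¬ pos i (rep (M.simple i) y)
  pos_alt : ∀ i j p y, i ≠ j → (M i j ≠ 0 → p < M i j) → pos i y → pos j y →
    pos j (rep (M.toCoxeterSystem.wordProd (altWord i j p)) y)

namespace Dominance

variable {B Y : Type*} {M : CoxeterMatrix B} (D : Dominance M Y) {J : Set B}

/-- `y` lies on the positive side of `s_j` for all `j ∈ J`. -/
def Dom (J : Set B) (y : Y) : Prop := ∀ j ∈ J, D.pos j y

/-- Split off the longest alternating prefix. Unless `s_j` has the dominant point translated by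
the word on its positive side, this prefix is one of the two sides of a braid relation. -/
theorem pos_or_exists_altWord {i j : B} (hij : i ≠ j) (hi : i ∈ J) (hj : j ∈ J) {ω : List B}
    (hω : MinWord M J (i :: ω)) {y : Y}
    (ih : ∀ (κ : B) (ω' : List B), κ ∈ J → ω'.length ≤ ω.length → MinWord M J (κ :: ω') →
      D.pos κ (D.rep (M.toCoxeterSystem.wordProd ω') y)) :
    D.pos j (D.rep (M.toCoxeterSystem.wordProd (i :: ω)) y) ∨
      M i j ≠ 0 ∧ ∃ ω', MinWord M J (altWord i j (M i j) ++ ω') ∧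
        M.toCoxeterSystem.wordProd (altWord i j (M i j) ++ ω') =
          M.toCoxeterSystem.wordProd (i :: ω) ∧
        (altWord i j (M i j) ++ ω').length = (i :: ω).length := by
  classical
  let Q : ℕ → Prop := fun p => ∃ ω', MinWord M J (altWord i j p ++ ω') ∧
        M.toCoxeterSystem.wordProd (altWord i j p ++ ω') =
          M.toCoxeterSystem.wordProd (i :: ω) ∧
        (altWord i j p ++ ω').length = (i :: ω).length
  have hQ1 : Q 1 := ⟨ω, hω, rfl, rfl⟩
  have hQle : ∀ p, Q p → p ≤ ω.length + 1 := by
    rintro p ⟨ω', -, -, h⟩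
    simp at h; omega
  set p := Nat.findGreatest Q (ω.length + 1) with hp
  have hQp : Q p := Nat.findGreatest_spec (m := 1) (by omega) hQ1
  have hp1 : 1 ≤ p := Nat.le_findGreatest (by omega) hQ1
  have hmax : ¬ Q (p + 1) := fun h => by
    have := Nat.le_findGreatest (hQle _ h) h
    omega
  by_cases hpm : M i j ≠ 0 → p < M i j
  · left
    obtain ⟨ω', h1, h2, h3⟩ := hQp
    -- the last letter `a` of the alternating prefix and the letter `b` that would continue it
    obtain ⟨a, b, ha, hb, hab, hsucc, hpred⟩ : ∃ a b : B, a ∈ J ∧ b ∈ J ∧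
        (a = i ∧ b = j ∨ a = j ∧ b = i) ∧
        altWord i j (p + 1) = altWord i j p ++ [b] ∧
        altWord i j p = altWord i j (p - 1) ++ [a] := by
      have e1 := altWord_add i j p 1
      have e2 := altWord_add i j (p - 1) 1
      rw [show p - 1 + 1 = p by omega] at e2
      rcases Nat.even_or_odd p with he | ho
      · have : ¬ Even (p - 1) := by grind
        exact ⟨j, i, hj, hi, Or.inr ⟨rfl, rfl⟩, by simpa [he, altWord] using e1,
          by simpa [this, altWord] using e2⟩
      · have h' : ¬ Even p := by simpa using ho
        have : Even (p - 1) := by grind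
        exact ⟨i, j, hi, hj, Or.inl ⟨rfl, rfl⟩, by simpa [h', altWord] using e1,
          by simpa [this, altWord] using e2⟩
    have hl : ω'.length ≤ ω.length := by
      simp at h3; omega
    have hma : MinWord M J (a :: ω') := by
      rw [hpred, List.append_assoc] at h1
      exact h1.of_append
    have hmb : MinWord M J (b :: ω') := by
      by_contra hcon
      obtain ⟨ω'', k1, k2, k3⟩ := hma.tail.exists_cons hb hcon
      have e : altWord i j (p + 1) ++ ω'' = altWord i j p ++ (b :: ω'') := by
        rw [hsucc, List.append_assoc]; rfl
      have e2 : M.toCoxeterSystem.wordProd (altWord i j (p + 1) ++ ω'') =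
          M.toCoxeterSystem.wordProd (altWord i j p ++ ω') := by
        rw [e, CoxeterSystem.wordProd_append, k2, ← CoxeterSystem.wordProd_append]
      have e3 : (altWord i j (p + 1) ++ ω'').length = (altWord i j p ++ ω').length := by
        rw [e, List.length_append, k3, List.length_append]
      refine hmax ⟨ω'', h1.congr ?_ e2 e3, e2.trans h2, e3.trans h3⟩
      intro k hk
      rw [e, List.mem_append] at hk
      rcases hk with hk | hk
      exacts [h1.1 k (by simp [hk]), k1.1 k hk]
    have hPa := ih a ω' ha hl hma
    have hPb := ih b ω' hb hl hmb
    have hPij : D.pos i (D.rep (M.toCoxeterSystem.wordProd ω') y) ∧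
        D.pos j (D.rep (M.toCoxeterSystem.wordProd ω') y) := by
      rcases hab with ⟨rfl, rfl⟩ | ⟨rfl, rfl⟩
      exacts [⟨hPa, hPb⟩, ⟨hPb, hPa⟩]
    have := D.pos_alt i j p _ hij hpm hPij.1 hPij.2
    rwa [← Equiv.Perm.mul_apply, ← map_mul, ← CoxeterSystem.wordProd_append, h2] at this
  · right
    push Not at hpm
    obtain ⟨hm0, hpm⟩ := hpm
    refine ⟨hm0, ?_⟩
    obtain ⟨ω', h1, h2, h3⟩ := hQp
    have e := altWord_add i j (M i j) (p - M i j)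
    rw [show M i j + (p - M i j) = p by omega] at e
    rw [e, List.append_assoc] at h1 h2 h3
    exact ⟨_, h1, h2, h3⟩

/-- If `j :: ω` is a minimal word in the letters of `J`, then the product of `ω` keeps a
`J`-dominant point on the positive side of `s_j`. -/
theorem pos_of_minWord {y : Y} (hy : D.Dom J y) {j : B} {ω : List B}
    (h : MinWord M J (j :: ω)) : D.pos j (D.rep (M.toCoxeterSystem.wordProd ω) y) := by
  induction hn : ω.length using Nat.strong_induction_on generalizing j ω with
  | _ n IH =>
    have hj : j ∈ J := h.1 j (by simp)
    cases ω with
    | nil => simpa using hy j hj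
    | cons i ω =>
      have hij : i ≠ j := by
        rintro rfl
        exact not_minWord_cons_self h
      have hi : i ∈ J := h.1 i (by simp)
      rcases D.pos_or_exists_altWord hij hi hj h.tail (y := y)
        (fun κ ω' _ hl hm => IH ω'.length (by simp at hn; omega) hm rfl) with hpos | hbr
      · exact hpos
      · -- a braid relation would give a minimal word for the product starting with `j`
        exfalso
        obtain ⟨hm0, ω', h1, h2, h3⟩ := hbr
        obtain ⟨q, hq⟩ := Nat.exists_eq_succ_of_ne_zero hm0
        have hw : M.toCoxeterSystem.wordProd (altWord i j q ++ ω') =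
            M.toCoxeterSystem.wordProd (j :: i :: ω) := by
          rw [CoxeterSystem.wordProd_cons, ← h2,
            CoxeterSystem.wordProd_append _ (altWord i j (M i j)),
            wordProd_braid, hq, altWord, ← CoxeterSystem.wordProd_append, List.cons_append,
            CoxeterSystem.wordProd_cons, CoxeterSystem.simple_mul_simple_cancel_left]
        have hl := h.2 _ (fun k hk => h1.1 k ?_) hw
        · simp [hq] at h3 hl
          omega
        · have hsub : ∀ (p : ℕ) (a b : B), ∀ k ∈ altWord a b p, k ∈ altWord a b (p + 1) := by
            intro p a b k hk
            rw [altWord_add]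
            simp [hk]
          rw [hq]
          rcases List.mem_append.1 hk with hk | hk
          · exact List.mem_append_left _ (hsub q i j k hk)
          · exact List.mem_append_right _ hk

theorem pos_iff_minWord {y : Y} (hy : D.Dom J y) {j : B} (hj : j ∈ J) {ω : List B}
    (h : MinWord M J ω) :
    D.pos j (D.rep (M.toCoxeterSystem.wordProd ω) y) ↔ MinWord M J (j :: ω) := by
  refine ⟨fun hp => ?_, D.pos_of_minWord hy⟩
  by_contra hn
  obtain ⟨ω', h1, h2, -⟩ := h.exists_cons hj hn
  have := D.pos_simple _ _ (D.pos_of_minWord hy h1)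
  rw [← Equiv.Perm.mul_apply, ← map_mul] at this
  rw [CoxeterSystem.wordProd_cons] at h2
  exact this (by rw [← h2] at hp; exact hp)

/-- The parabolic subgroup `W_J` acts simply transitively on its chambers. -/
theorem eq_one_of_dom {y : Y} (hy : D.Dom J y) {w : M.Group} (hw : w ∈ parabolicSubgroup M J)
    (h : D.Dom J (D.rep w y)) : w = 1 := by
  obtain ⟨ω, h1, rfl⟩ := exists_minWord_of_mem hw
  cases ω with
  | nil => simp
  | cons i ω =>
    have := (D.pos_iff_minWord hy (h1.1 i (by simp)) h1).1 (h i (h1.1 i (by simp)))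
    exact absurd this not_minWord_cons_self

theorem length_simple_mul_of_pos {y : Y} (hy : D.Dom Set.univ y) {i : B} {w : M.Group}
    (h : D.pos i (D.rep w y)) :
    M.toCoxeterSystem.length (M.simple i * w) = M.toCoxeterSystem.length w + 1 := by
  obtain ⟨ω, hω, rfl⟩ := M.toCoxeterSystem.exists_isReduced w
  have h1 := (D.pos_iff_minWord hy trivial (minWord_univ.2 hω)).1 h
  have h2 := (minWord_univ.1 h1).eq
  rw [CoxeterSystem.wordProd_cons, List.length_cons, ← hω.eq] at h2
  exact h2

theorem pos_of_length_simple_mul {y : Y} (hy : D.Dom Set.univ y) {i : B} {w : M.Group}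
    (h : M.toCoxeterSystem.length w < M.toCoxeterSystem.length (M.simple i * w)) :
    D.pos i (D.rep w y) := by
  obtain ⟨ω, hω, rfl⟩ := M.toCoxeterSystem.exists_isReduced w
  refine D.pos_of_minWord hy (minWord_univ.2 ?_)
  have h1 := M.toCoxeterSystem.length_wordProd_le (i :: ω)
  rw [CoxeterSystem.IsReduced]
  rw [hω.eq] at h
  rw [CoxeterSystem.wordProd_cons, List.length_cons, CoxeterMatrix.toCoxeterSystem_simple] at h1 ⊢
  omega

/-- If `u` is the shortest element of its coset `W_J u`, then lengths add up in `v u`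
for `v ∈ W_J`. -/
theorem length_mul_of_dom {y : Y} (hy : D.Dom Set.univ y) {u v : M.Group}
    (hv : v ∈ parabolicSubgroup M J) (hu : D.Dom J (D.rep u y)) :
    M.toCoxeterSystem.length (v * u) =
      M.toCoxeterSystem.length v + M.toCoxeterSystem.length u := by
  have key : ∀ (ω : List B) (u : M.Group), MinWord M J ω → D.Dom J (D.rep u y) →
      M.toCoxeterSystem.length (M.toCoxeterSystem.wordProd ω * u) =
        ω.length + M.toCoxeterSystem.length u := by
    intro ω u hω hu
    induction ω with
    | nil => simp
    | cons i ω ih =>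
      have h1 := D.pos_of_minWord hu hω
      rw [← Equiv.Perm.mul_apply, ← map_mul] at h1
      have h2 := D.length_simple_mul_of_pos hy h1
      rw [CoxeterSystem.wordProd_cons, mul_assoc, CoxeterMatrix.toCoxeterSystem_simple, h2,
        ih hω.tail, List.length_cons]
      omega
  obtain ⟨ω, hω, rfl⟩ := exists_minWord_of_mem hv
  have h1 := key ω 1 hω (by
    rw [map_one]
    exact fun j _ => hy j trivial)
  rw [mul_one, CoxeterSystem.length_one, add_zero] at h1
  rw [key ω u hω hu, h1]

theorem isReduced_altWord {y : Y} (hy : D.Dom Set.univ y) {i j : B} (hij : i ≠ j)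
    (p : ℕ) (hp : M i j ≠ 0 → p ≤ M i j) :
    M.toCoxeterSystem.IsReduced (altWord i j p) := by
  induction p generalizing i j with
  | zero => simp [altWord, CoxeterSystem.IsReduced]
  | succ p ih =>
    have h1 := ih hij.symm (fun h => by rw [M.symmetric] at h ⊢; have := hp h; omega)
    have h2 := D.pos_alt j i p y hij.symm
      (fun h => by rw [M.symmetric] at h ⊢; have := hp h; omega) (hy _ trivial) (hy _ trivial)
    have h3 := D.length_simple_mul_of_pos hy h2
    rw [CoxeterSystem.IsReduced, altWord, CoxeterSystem.wordProd_cons,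
      CoxeterMatrix.toCoxeterSystem_simple, h3, h1.eq, List.length_cons]

/-- The theorem of Matsumoto and Tits: reduced words with the same product in the Coxeter group
represent the same element of the Artin monoid. -/
theorem wordGen_eq_of_isReduced {y : Y} (hy : D.Dom Set.univ y) {ω ω' : List B}
    (h : M.toCoxeterSystem.IsReduced ω) (h' : M.toCoxeterSystem.IsReduced ω')
    (hw : M.toCoxeterSystem.wordProd ω = M.toCoxeterSystem.wordProd ω') :
    wordGen M ω = wordGen M ω' := by
  induction hn : ω.length generalizing ω ω' with
  | zero =>
    have hl : ω'.length = ω.length := by rw [← h'.eq, ← h.eq, hw]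
    rw [List.length_eq_zero_iff.1 hn, List.length_eq_zero_iff.1 (hl.trans hn)]
  | succ n IH =>
    have hl : ω'.length = ω.length := by rw [← h'.eq, ← h.eq, hw]
    obtain ⟨i, a, rfl⟩ := List.exists_cons_of_length_eq_add_one hn
    obtain ⟨j, b, rfl⟩ := List.exists_cons_of_length_eq_add_one (hl.trans hn)
    -- words with the same first letter are covered by the induction hypothesis
    have same : ∀ (i : B) (a b : List B), M.toCoxeterSystem.IsReduced (i :: a) →
        M.toCoxeterSystem.IsReduced (i :: b) → (i :: a).length = n + 1 →
        M.toCoxeterSystem.wordProd (i :: a) = M.toCoxeterSystem.wordProd (i :: b) →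
        wordGen M (i :: a) = wordGen M (i :: b) := by
      intro i a b ha hb hn hw
      rw [CoxeterSystem.wordProd_cons, CoxeterSystem.wordProd_cons] at hw
      rw [wordGen_cons, wordGen_cons, IH (minWord_univ.1 (minWord_univ.2 ha).tail)
        (minWord_univ.1 (minWord_univ.2 hb).tail) (mul_left_cancel hw) (by simpa using hn)]
    by_cases hij : i = j
    · subst hij
      exact same i a b h h' hn hw
    · rcases D.pos_or_exists_altWord hij (Set.mem_univ i) (Set.mem_univ j) (minWord_univ.2 h)
        (y := y) (fun κ ω' _ _ hm => D.pos_of_minWord hy hm) with hpos | ⟨hm0, ω'', h1, h2, h3⟩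
      · exfalso
        rw [hw] at hpos
        exact not_minWord_cons_self
          ((D.pos_iff_minWord hy trivial (minWord_univ.2 h')).1 hpos)
      · have h4 : M.toCoxeterSystem.wordProd (altWord j i (M i j) ++ ω'') =
            M.toCoxeterSystem.wordProd (altWord i j (M i j) ++ ω'') := by
          rw [CoxeterSystem.wordProd_append, ← wordProd_braid, CoxeterSystem.wordProd_append]
        have h5 : MinWord M Set.univ (altWord j i (M i j) ++ ω'') :=
          h1.congr (by simp) h4 (by simp)
        have h6 : wordGen M (altWord j i (M i j) ++ ω'') =
            wordGen M (altWord i j (M i j) ++ ω'') := by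
          rw [wordGen_append, ← wordGen_braid M hij hm0, wordGen_append]
        obtain ⟨q, hq⟩ := Nat.exists_eq_succ_of_ne_zero hm0
        rw [hq] at h1 h2 h4 h5 h6 h3
        simp only [altWord, List.cons_append] at h1 h2 h4 h5 h6 h3
        rw [same i a _ h (minWord_univ.1 h1) hn h2.symm, ← h6,
          same j b _ h' (minWord_univ.1 h5) (hl.trans hn) (by rw [h4, h2, hw])]

theorem eq_of_squareFree {y : Y} (hy : D.Dom Set.univ y) {X X' : ArtinMonoid M}
    (h : SquareFree M X) (h' : SquareFree M X') (hp : proj M X = proj M X') : X = X' := by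
  obtain ⟨ω, rfl⟩ := wordGen_surjective M X
  obtain ⟨ω', rfl⟩ := wordGen_surjective M X'
  rw [proj_wordGen, proj_wordGen] at hp
  exact D.wordGen_eq_of_isReduced hy ((squareFree_wordGen M).1 h) ((squareFree_wordGen M).1 h') hp

theorem eq_lift {y : Y} (hy : D.Dom Set.univ y) {X : ArtinMonoid M}
    (h : SquareFree M X) : X = lift M (proj M X) :=
  D.eq_of_squareFree hy h (squareFree_lift M _) (by simp)

end Dominance

/-! ### Longest elements -/

section Longest

variable {B : Type*} {M : CoxeterMatrix B} {J : Set B}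

theorem finiteType_of_univ (h : FiniteType M Set.univ) (J : Set B) : FiniteType M J :=
  h.subset fun _ hx => parabolicSubgroup_mono (Set.subset_univ J) hx

theorem parabolicSubgroup_univ : parabolicSubgroup M Set.univ = ⊤ := by
  rw [parabolicSubgroup, Set.image_univ]
  exact M.toCoxeterSystem.subgroup_closure_range_simple

theorem longest_mem (J : Set B) : longest M J ∈ parabolicSubgroup M J := by
  unfold longest
  split_ifs with h
  · exact (Classical.choose_spec (exists_longest M J h)).1
  · exact one_mem _

theorem length_le_length_longest (hJ : FiniteType M J) {u : M.Group}
    (hu : u ∈ parabolicSubgroup M J) :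
    M.toCoxeterSystem.length u ≤ M.toCoxeterSystem.length (longest M J) := by
  unfold longest
  rw [dif_pos hJ]
  exact (Classical.choose_spec (exists_longest M J hJ)).2 u hu

theorem length_simple_mul_longest_lt (hJ : FiniteType M J) {j : B} (hj : j ∈ J) :
    M.toCoxeterSystem.length (M.simple j * longest M J) <
      M.toCoxeterSystem.length (longest M J) := by
  have h1 := length_le_length_longest hJ
    (mul_mem (simple_mem_parabolicSubgroup hj) (longest_mem J))
  have h2 := M.toCoxeterSystem.length_simple_mul_ne (longest M J) j
  rw [CoxeterMatrix.toCoxeterSystem_simple] at h2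
  omega

theorem longest_empty : longest M (∅ : Set B) = 1 := by
  have := longest_mem (M := M) (∅ : Set B)
  simpa [parabolicSubgroup] using this

end Longest

/-! ### Signed permutations of coordinates -/

section SignedPermutations

/-- The action of the `i`-th simple reflection of `B_n` on sequences (coordinates are numbered
from `0`): it swaps the coordinates `i` and `i + 1`, except for the last one, which negates the
coordinate `n - 1`. -/
def reflB (n i : ℕ) (y : ℕ → ℤ) : ℕ → ℤ := fun k =>
  if i + 1 = n then (if k = i then -y k else y k)
  else if k = i then y (i + 1) else if k = i + 1 then y i else y k

theorem reflB_reflB (n i : ℕ) (y : ℕ → ℤ) : reflB n i (reflB n i y) = y := by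
  funext k
  unfold reflB
  grind

/-- The permutation of the set of sequences underlying `reflB`. -/
def reflPermB (n i : ℕ) : Equiv.Perm (ℕ → ℤ) where
  toFun := reflB n i
  invFun := reflB n i
  left_inv := reflB_reflB n i
  right_inv := reflB_reflB n i

theorem matB_apply (n : ℕ) (i j : Fin n) : matB n i j =
    if (i : ℕ) = j then 1
    else if (i : ℕ) + 1 = j ∨ (j : ℕ) + 1 = i then
      (if (i : ℕ) + 1 = n ∨ (j : ℕ) + 1 = n then 4 else 3)
    else 2 := by
  change (if _ then _ else _) = _
  simp only [Fin.ext_iff]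
  split_ifs <;> first | rfl | omega

theorem reflB_braid_four {n i j : ℕ} (e1 : j = i + 1) (e2 : j + 1 = n) {y : ℕ → ℤ} (k : ℕ) :
    reflB n i (reflB n j (reflB n i (reflB n j (reflB n i (reflB n j
      (reflB n i (reflB n j y))))))) k = y k := by
  subst e1 e2
  by_cases hk1 : k = i
  · subst hk1; simp [reflB]
  · by_cases hk2 : k = i + 1
    · subst hk2; simp [reflB]
    · simp [reflB, hk1, hk2]

theorem reflB_braid_three {n i j : ℕ} (e1 : j = i + 1) (e2 : j + 1 ≠ n) {y : ℕ → ℤ} (k : ℕ)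
    (e3 : i + 1 ≠ n := by omega) :
    reflB n i (reflB n j (reflB n i (reflB n j (reflB n i (reflB n j y))))) k = y k := by
  subst e1
  have h1 : ¬ i + 1 + 1 = i := by omega
  have h2 : ¬ i = i + 1 + 1 := by omega
  have h4 : ¬ i = i + 2 := by omega
  by_cases hk1 : k = i
  · subst hk1; simp [reflB, e2, e3, h1, h2]
  · by_cases hk2 : k = i + 1
    · subst hk2; simp [reflB, e2, e3, h1, h2]
    · by_cases hk3 : k = i + 2
      · subst hk3; simp [reflB, e2, e3, h2]
      · simp [reflB, e2, e3, hk1, hk2, hk3]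

theorem reflPermB_liftable (n : ℕ) :
    (matB n).IsLiftable fun i : Fin n => reflPermB n i := by
  have key : ∀ i j : Fin n, (i : ℕ) ≤ j →
      (reflPermB n i * reflPermB n j) ^ (matB n i j) = 1 := by
    intro i j hij
    have hi := i.2
    have hj := j.2
    rw [matB_apply]
    apply Equiv.ext
    intro y
    split_ifs with h1 h2 h3
    · rw [h1, pow_one]; exact reflB_reflB n j y
    · funext k
      simp only [pow_succ, pow_zero, one_mul, Equiv.Perm.mul_apply, Equiv.Perm.one_apply]
      exact reflB_braid_four (by omega) (by omega) k
    · funext k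
      simp only [pow_succ, pow_zero, one_mul, Equiv.Perm.mul_apply, Equiv.Perm.one_apply]
      exact reflB_braid_three (by omega) (by omega) k
    · funext k
      simp only [pow_succ, pow_zero, one_mul, Equiv.Perm.mul_apply, Equiv.Perm.one_apply]
      change reflB n i (reflB n j (reflB n i (reflB n j y))) k = y k
      have e1 : (i : ℕ) + 1 < j := by omega
      unfold reflB
      grind
  intro i j
  rcases le_total (i : ℕ) j with h | h
  · exact key i j h
  · have := key j i h
    rw [(matB n).symmetric] at this
    have h2 := congrArg (·⁻¹) this
    simpa [← inv_pow, mul_inv_rev, show ∀ i, (reflPermB n i)⁻¹ = reflPermB n i from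
      fun i => rfl] using h2

/-- The action of the Coxeter group of type `B_n` on integer sequences by signed permutations of
the first `n` coordinates. -/
def repB (n : ℕ) : (matB n).Group →* Equiv.Perm (ℕ → ℤ) :=
  (matB n).toCoxeterSystem.lift ⟨_, reflPermB_liftable n⟩

theorem repB_simple (n : ℕ) (i : Fin n) (y : ℕ → ℤ) :
    repB n ((matB n).simple i) y = reflB n i y := by
  have := (matB n).toCoxeterSystem.lift_apply_simple (reflPermB_liftable n) i
  rw [CoxeterMatrix.toCoxeterSystem_simple] at this
  rw [repB, this]
  rfl

/-- The positive side of the `i`-th simple reflection. -/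
def posB (n i : ℕ) (y : ℕ → ℤ) : Prop := if i + 1 = n then 0 < y i else y (i + 1) < y i

theorem posB_neg_iff (n i : ℕ) (y : ℕ → ℤ) : posB n i (-y) ↔ posB n i (reflB n i y) := by
  unfold posB reflB
  grind [Pi.neg_apply]

theorem repB_mul (n : ℕ) (v w : (matB n).Group) (y : ℕ → ℤ) :
    repB n (v * w) y = repB n v (repB n w y) := by
  rw [map_mul]; rfl

theorem repB_simple_mul (n : ℕ) (i : Fin n) (w : (matB n).Group) (y : ℕ → ℤ) :
    repB n ((matB n).simple i * w) y = reflB n i (repB n w y) := by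
  rw [repB_mul, repB_simple]

theorem repB_wordProd_cons (n : ℕ) (i : Fin n) (ω : List (Fin n)) (y : ℕ → ℤ) :
    repB n ((matB n).toCoxeterSystem.wordProd (i :: ω)) y =
      reflB n i (repB n ((matB n).toCoxeterSystem.wordProd ω) y) := by
  rw [CoxeterSystem.wordProd_cons, CoxeterMatrix.toCoxeterSystem_simple, repB_simple_mul]

/-- Signed permutations of coordinates, with the half spaces `y_i > y_{i+1}` and `y_n > 0`. -/
def domB (n : ℕ) : Dominance (matB n) (ℕ → ℤ) where
  rep := repB n
  pos i y := posB n i y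
  pos_simple i y := by
    rw [repB_simple]
    unfold posB reflB
    split_ifs <;> simp <;> omega
  pos_alt i j p y hij hp hi hj := by
    have hi2 := i.2
    have hj2 := j.2
    have hne : (i : ℕ) ≠ j := fun h => hij (Fin.ext h)
    have hp4 : p < 4 := by
      rw [matB_apply] at hp
      split_ifs at hp <;> omega
    rw [matB_apply] at hp
    interval_cases p
    · simpa [altWord] using hj
    · simp only [altWord, repB_wordProd_cons, CoxeterSystem.wordProd_nil, map_one,
        Equiv.Perm.one_apply]
      unfold posB reflB at *
      grind
    · simp only [altWord, repB_wordProd_cons, CoxeterSystem.wordProd_nil, map_one,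
        Equiv.Perm.one_apply]
      unfold posB reflB at *
      grind
    · simp only [altWord, repB_wordProd_cons, CoxeterSystem.wordProd_nil, map_one,
        Equiv.Perm.one_apply]
      unfold posB reflB at *
      grind

end SignedPermutations

/-! ### Square free elements and homomorphisms -/

section SquareFree

variable {B B' Y : Type*} {M : CoxeterMatrix B} {M' : CoxeterMatrix B'}

theorem SquareFree.mul {X X' : ArtinMonoid M} (h : SquareFree M X) (h' : SquareFree M X')
    (hl : M.toCoxeterSystem.length (proj M X * proj M X') =
      M.toCoxeterSystem.length (proj M X) + M.toCoxeterSystem.length (proj M X')) :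
    SquareFree M (X * X') := by
  rw [SquareFree, map_mul, hl, length_mul, h, h']

theorem squareFree_one : SquareFree M 1 := by simp [SquareFree]

theorem squareFree_gen (i : B) : SquareFree M (gen M i) := by
  rw [SquareFree, proj_gen, length_gen, ← CoxeterMatrix.toCoxeterSystem_simple,
    CoxeterSystem.length_simple]

/-- A homomorphism of Coxeter groups under which lengths add up along reduced words lifts to the
Artin monoids, compatibly with the sections `w ↦ T_w`. -/
theorem Dominance.exists_hom (D : Dominance M Y) {y : Y} (hy : D.Dom Set.univ y)
    (φ : M'.Group →* M.Group)
    (hadd : ∀ (w : M'.Group) (i : B'),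
      M'.toCoxeterSystem.length w < M'.toCoxeterSystem.length (M'.simple i * w) →
      M.toCoxeterSystem.length (φ (M'.simple i) * φ w) =
        M.toCoxeterSystem.length (φ (M'.simple i)) + M.toCoxeterSystem.length (φ w))
    (hred : ∀ i j : B', i ≠ j → M' i j ≠ 0 →
      M'.toCoxeterSystem.IsReduced (altWord i j (M' i j))) :
    ∃ Φ : ArtinMonoid M' →* ArtinMonoid M,
      (∀ i, Φ (gen M' i) = lift M (φ (M'.simple i))) ∧
      ∀ w, Φ (lift M' w) = lift M (φ w) := by
  have key : ∀ ω : List B', M'.toCoxeterSystem.IsReduced ω →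
      SquareFree M (ω.map fun i => lift M (φ (M'.simple i))).prod ∧
      proj M (ω.map fun i => lift M (φ (M'.simple i))).prod =
        φ (M'.toCoxeterSystem.wordProd ω) := by
    intro ω hω
    induction ω with
    | nil => simpa using squareFree_one
    | cons i ω ih =>
      have hω' := minWord_univ.1 (minWord_univ.2 hω).tail
      obtain ⟨h1, h2⟩ := ih hω'
      have h3 := hadd (M'.toCoxeterSystem.wordProd ω) i (by
        have := hω.eq
        rw [CoxeterSystem.wordProd_cons, CoxeterMatrix.toCoxeterSystem_simple,
          List.length_cons] at this
        rw [hω'.eq, this]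
        omega)
      rw [List.map_cons, List.prod_cons, CoxeterSystem.wordProd_cons,
        CoxeterMatrix.toCoxeterSystem_simple]
      refine ⟨(squareFree_lift M _).mul h1 ?_, by rw [map_mul, proj_lift, h2, map_mul]⟩
      rw [h2, proj_lift]
      exact h3
  let Φ : ArtinMonoid M' →* ArtinMonoid M :=
    PresentedMonoid.lift (fun i => lift M (φ (M'.simple i))) (by
      rintro a b ⟨i, j, hij, hm, rfl, rfl⟩
      simp only [map_brd, FreeMonoid.lift_eval_of]
      rw [← prod_map_altWord (fun i => lift M (φ (M'.simple i))),
        ← prod_map_altWord (fun i => lift M (φ (M'.simple i)))]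
      have h1 := key _ (hred i j hij hm)
      have h2 := key _ (hred j i hij.symm (by rwa [M'.symmetric]))
      rw [M'.symmetric j i] at h2
      exact D.eq_of_squareFree hy h1.1 h2.1 (by rw [h1.2, h2.2, wordProd_braid]))
  have hgen : ∀ i, Φ (gen M' i) = lift M (φ (M'.simple i)) := fun i => rfl
  refine ⟨Φ, hgen, fun w => ?_⟩
  obtain ⟨ω, hω⟩ := wordGen_surjective M' (lift M' w)
  have h1 := squareFree_lift M' w
  rw [← hω, squareFree_wordGen] at h1
  have h2 := key ω h1
  have h3 : Φ (wordGen M' ω) = (ω.map fun i => lift M (φ (M'.simple i))).prod := by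
    rw [wordGen, map_list_prod, List.map_map]
    rfl
  rw [← hω, h3]
  refine D.eq_of_squareFree hy h2.1 (squareFree_lift M _) ?_
  rw [h2.2, proj_lift, ← proj_wordGen, hω, proj_lift]

end SquareFree

/-! ### The Coxeter group of type `B_n` -/

section TypeB

variable {n : ℕ}

/-- The sequence `(n, n - 1, …, 1, 0, 0, …)`. -/
def rhoB (n : ℕ) : ℕ → ℤ := fun k => ((n - k : ℕ) : ℤ)

theorem dom_rhoB (n : ℕ) : (domB n).Dom Set.univ (rhoB n) := by
  intro j _
  change posB n j (rhoB n)
  have := j.2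
  unfold posB rhoB
  split_ifs <;> omega

theorem repB_one (y : ℕ → ℤ) : repB n 1 y = y := by rw [map_one]; rfl

theorem reflB_neg (i : ℕ) (y : ℕ → ℤ) : reflB n i (-y) = -reflB n i y := by
  funext k
  simp only [reflB, Pi.neg_apply]
  split_ifs <;> rfl

theorem repB_neg (w : (matB n).Group) (y : ℕ → ℤ) : repB n w (-y) = -repB n w y := by
  refine (matB n).toCoxeterSystem.simple_induction_left
    (p := fun w => repB n w (-y) = -repB n w y) w ?_ fun w i ih => ?_
  · simp
  · rw [CoxeterMatrix.toCoxeterSystem_simple, repB_simple_mul, repB_simple_mul, ih, reflB_neg]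

theorem repB_of_le (w : (matB n).Group) (y : ℕ → ℤ) {k : ℕ} (hk : n ≤ k) :
    repB n w y k = y k := by
  refine (matB n).toCoxeterSystem.simple_induction_left
    (p := fun w => repB n w y k = y k) w ?_ fun w i ih => ?_
  · simp
  · have := i.2
    rw [CoxeterMatrix.toCoxeterSystem_simple, repB_simple_mul]
    unfold reflB
    split_ifs <;> first | exact ih | omega

theorem abs_repB_le (w : (matB n).Group) (y : ℕ → ℤ) {C : ℤ} (hC : ∀ k, |y k| ≤ C) (k : ℕ) :
    |repB n w y k| ≤ C := by
  revert k
  refine (matB n).toCoxeterSystem.simple_induction_left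
    (p := fun w => ∀ k, |repB n w y k| ≤ C) w ?_ fun w i ih k => ?_
  · simpa [repB_one] using hC
  · rw [CoxeterMatrix.toCoxeterSystem_simple, repB_simple_mul]
    unfold reflB
    split_ifs <;> simp [ih]

theorem length_simple_mul_of_posB {i : Fin n} {w : (matB n).Group}
    (h : posB n i (repB n w (rhoB n))) :
    (matB n).toCoxeterSystem.length ((matB n).simple i * w) =
      (matB n).toCoxeterSystem.length w + 1 :=
  (domB n).length_simple_mul_of_pos (dom_rhoB n) h

theorem eq_of_repB_eq {y : ℕ → ℤ} (hy : (domB n).Dom Set.univ y) {v w : (matB n).Group}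
    (h : repB n v y = repB n w y) : v = w := by
  have : w⁻¹ * v = 1 := by
    refine (domB n).eq_one_of_dom hy (by rw [parabolicSubgroup_univ]; trivial) ?_
    change (domB n).Dom _ (repB n (w⁻¹ * v) y)
    rwa [repB_mul, h, ← repB_mul, inv_mul_cancel, repB_one]
  rw [inv_mul_eq_one] at this
  exact this.symm

theorem finiteType_matB (J : Set (Fin n)) : FiniteType (matB n) J := by
  refine finiteType_of_univ (Set.Finite.subset ?_ (Set.subset_univ _)) J
  rw [Set.finite_univ_iff]
  have hb : ∀ k, |rhoB n k| ≤ n := by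
    intro k
    unfold rhoB
    rw [abs_le]
    omega
  let f : (matB n).Group → (Fin n → Set.Icc (-(n : ℤ)) n) := fun w k =>
    ⟨repB n w (rhoB n) k, abs_le.1 (abs_repB_le w _ hb _)⟩
  refine Finite.of_injective f fun v w h => eq_of_repB_eq (dom_rhoB n) ?_
  funext k
  by_cases hk : k < n
  · exact congrArg Subtype.val (congrFun h ⟨k, hk⟩)
  · rw [repB_of_le _ _ (not_lt.1 hk), repB_of_le _ _ (not_lt.1 hk)]

theorem dom_neg_longest {y : ℕ → ℤ} (hy : (domB n).Dom Set.univ y) (J : Set (Fin n)) :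
    (domB n).Dom J (-repB n (longest (matB n) J) y) := by
  intro j hj
  change posB n j _
  rw [posB_neg_iff, ← repB_simple_mul]
  refine (domB n).pos_of_length_simple_mul hy ?_
  have h := length_simple_mul_longest_lt (finiteType_matB J) hj
  rwa [← mul_assoc, ← CoxeterMatrix.toCoxeterSystem_simple,
    CoxeterSystem.simple_mul_simple_self, one_mul]

/-- The longest element of `W_J` is the one that maps the dominant chamber to the `J`-antidominant
chamber. -/
theorem eq_longest {y : ℕ → ℤ} (hy : (domB n).Dom Set.univ y) {J : Set (Fin n)}
    {w : (matB n).Group} (hw : w ∈ parabolicSubgroup (matB n) J)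
    (h : (domB n).Dom J (-repB n w y)) : w = longest (matB n) J := by
  have h1 : w * (longest (matB n) J)⁻¹ = 1 := by
    refine (domB n).eq_one_of_dom (dom_neg_longest hy J)
      (mul_mem hw (inv_mem (longest_mem J))) ?_
    change (domB n).Dom J (repB n _ _)
    rwa [← repB_neg, ← repB_mul, inv_mul_cancel_right, repB_neg]
  rwa [mul_inv_eq_one] at h1

/-- The cyclic permutation of the coordinates `a, …, a + l` that moves the last one to the front. -/
theorem exists_cycle (a l : ℕ) (h : a + l < n) :
    ∃ w ∈ parabolicSubgroup (matB n) {i : Fin n | a ≤ i ∧ (i : ℕ) < a + l}, ∀ y k,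
      repB n w y k = if k = a then y (a + l) else if a < k ∧ k ≤ a + l then y (k - 1) else y k := by
  induction l with
  | zero =>
    refine ⟨1, one_mem _, fun y k => ?_⟩
    rw [repB_one]
    grind
  | succ l ih =>
    obtain ⟨w, hw, hy⟩ := ih (by omega)
    refine ⟨w * (matB n).simple ⟨a + l, by omega⟩,
      mul_mem (parabolicSubgroup_mono ?_ hw) (simple_mem_parabolicSubgroup ?_), fun y k => ?_⟩
    · intro i hi
      simp only [Set.mem_ofPred_eq] at hi ⊢
      omega
    · simp only [Set.mem_ofPred_eq]
      omega
    · rw [repB_mul, hy, repB_simple]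
      unfold reflB
      grind

/-- The reversal of the coordinates `a, …, a + l`. -/
theorem exists_reversal (a l : ℕ) (h : a + l < n) :
    ∃ w ∈ parabolicSubgroup (matB n) {i : Fin n | a ≤ i ∧ (i : ℕ) < a + l}, ∀ y k,
      repB n w y k = if a ≤ k ∧ k ≤ a + l then y (2 * a + l - k) else y k := by
  induction l with
  | zero =>
    refine ⟨1, one_mem _, fun y k => ?_⟩
    rw [repB_one]
    grind
  | succ l ih =>
    obtain ⟨w, hw, hy⟩ := ih (by omega)
    obtain ⟨c, hc, hcy⟩ := exists_cycle a (l + 1) h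
    refine ⟨c * w, mul_mem hc (parabolicSubgroup_mono ?_ hw), fun y k => ?_⟩
    · intro i hi
      simp only [Set.mem_ofPred_eq] at hi ⊢
      omega
    · rw [repB_mul, hcy, hy, hy, hy]
      grind

theorem genB_of_le {k : ℕ} (h1 : 1 ≤ k) (h2 : k ≤ n) :
    genB n k = gen (matB n) ⟨k - 1, by omega⟩ := by
  rw [genB, dif_pos ⟨h1, h2⟩]

theorem palindromeB_self (n : ℕ) : palindromeB n n = genB n n := by
  simp [palindromeB]

theorem palindromeB_of_lt {m : ℕ} (h : m < n) :
    palindromeB n m = genB n m * palindromeB n (m + 1) * genB n m := by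
  unfold palindromeB
  rw [List.Ico.eq_cons h]
  simp [mul_assoc]

theorem repB_genB {k : ℕ} (h1 : 1 ≤ k) (h2 : k ≤ n) (y : ℕ → ℤ) :
    repB n (proj _ (genB n k)) y = reflB n (k - 1) y := by
  rw [genB_of_le h1 h2, proj_gen, repB_simple]

/-- The palindrome `T_m ⋯ T_n ⋯ T_m` negates one coordinate. -/
theorem palindromeB_spec (d m : ℕ) (hm : 1 ≤ m) (hd : m + d = n) :
    proj _ (palindromeB n m) ∈ parabolicSubgroup (matB n) {i : Fin n | m ≤ (i : ℕ) + 1} ∧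
    (∀ y k, repB n (proj _ (palindromeB n m)) y k = if k + 1 = m then -y k else y k) ∧
    ∀ w : (matB n).Group, (∀ j, m ≤ j → j < n →
        |repB n w (rhoB n) j| < repB n w (rhoB n) (m - 1)) → 0 < repB n w (rhoB n) (m - 1) →
      (matB n).toCoxeterSystem.length (proj _ (palindromeB n m) * w) =
        length _ (palindromeB n m) + (matB n).toCoxeterSystem.length w := by
  induction d generalizing m with
  | zero =>
    obtain rfl : m = n := by omega
    rw [palindromeB_self, genB_of_le hm le_rfl, proj_gen]
    refine ⟨simple_mem_parabolicSubgroup ?_, fun y k => ?_, fun w _ h => ?_⟩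
    · simp only [Set.mem_ofPred_eq]
      omega
    · rw [repB_simple]
      unfold reflB
      grind
    · rw [length_gen, length_simple_mul_of_posB, add_comm]
      unfold posB
      simpa [show m - 1 + 1 = m by omega] using h
  | succ d ih =>
    obtain ⟨h1, h2, h3⟩ := ih (m + 1) (by omega) (by omega)
    rw [palindromeB_of_lt (by omega), genB_of_le hm (by omega), map_mul, map_mul, proj_gen]
    have hs : (matB n).simple ⟨m - 1, by omega⟩ ∈
        parabolicSubgroup (matB n) {i : Fin n | m ≤ (i : ℕ) + 1} :=
      simple_mem_parabolicSubgroup (by simp only [Set.mem_ofPred_eq]; omega)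
    refine ⟨mul_mem (mul_mem hs (parabolicSubgroup_mono ?_ h1)) hs, fun y k => ?_,
      fun w ha hp => ?_⟩
    · intro i hi
      simp only [Set.mem_ofPred_eq] at hi ⊢
      omega
    · rw [repB_mul, repB_mul, repB_simple, repB_simple]
      simp only [reflB, h2]
      grind
    · have hpos : ∀ v : (matB n).Group, repB n v (rhoB n) m < repB n v (rhoB n) (m - 1) →
          (matB n).toCoxeterSystem.length ((matB n).simple ⟨m - 1, by omega⟩ * v) =
            (matB n).toCoxeterSystem.length v + 1 := by
        intro v hv
        refine length_simple_mul_of_posB ?_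
        unfold posB
        rw [if_neg (by simp only; omega)]
        simpa [show m - 1 + 1 = m by omega] using hv
      have e : ∀ j, repB n ((matB n).simple ⟨m - 1, by omega⟩ * w) (rhoB n) j =
          if j + 1 = m then repB n w (rhoB n) m else if j = m then repB n w (rhoB n) (m - 1)
          else repB n w (rhoB n) j := by
        intro j
        rw [repB_simple_mul]
        simp only [reflB, show m - 1 + 1 = m by omega]
        grind
      have ham := ha m le_rfl (by omega)
      have ham' := abs_lt.1 ham
      have k1 := h3 ((matB n).simple ⟨m - 1, by omega⟩ * w)
        (fun j hj hjn => by
          rw [e, e]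
          have := ha j (by omega) hjn
          rw [if_neg (by omega), if_neg (by omega)]
          simpa using this)
        (by rw [e]; simpa using hp)
      have k2 := hpos _ ham'.2
      have k3 := hpos (proj _ (palindromeB n (m + 1)) *
        ((matB n).simple ⟨m - 1, by omega⟩ * w)) (by
          rw [repB_mul, h2, h2, e, e]
          grind)
      rw [mul_assoc, mul_assoc, k3, k1, k2, length_mul, length_mul, length_gen]
      omega

theorem squareFree_palindromeB {m : ℕ} (h1 : 1 ≤ m) (h2 : m ≤ n) :
    SquareFree _ (palindromeB n m) := by
  have := (palindromeB_spec (n := n) (n - m) m h1 (by omega)).2.2 1 (fun j hj hjn => by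
    simp only [repB_one, rhoB]
    rw [abs_lt]; omega) (by simp only [repB_one, rhoB]; omega)
  simpa [SquareFree] using this

/-- The sign change of the coordinates `k, …, n - 1`. -/
theorem exists_negation (k d : ℕ) (hd : k + d = n) :
    ∃ w ∈ parabolicSubgroup (matB n) {i : Fin n | k ≤ i}, ∀ y j,
      repB n w y j = if k ≤ j ∧ j < n then -y j else y j := by
  induction d generalizing k with
  | zero =>
    refine ⟨1, one_mem _, fun y j => ?_⟩
    rw [repB_one, if_neg (by omega)]
  | succ d ih =>
    obtain ⟨w, hw, hy⟩ := ih (k + 1) (by omega)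
    obtain ⟨h1, h2, -⟩ := palindromeB_spec (n := n) d (k + 1) (by omega) (by omega)
    refine ⟨_, mul_mem (parabolicSubgroup_mono ?_ h1) (parabolicSubgroup_mono ?_ hw),
      fun y j => ?_⟩
    · intro i hi
      simp only [Set.mem_ofPred_eq] at hi ⊢
      omega
    · intro i hi
      simp only [Set.mem_ofPred_eq] at hi ⊢
      omega
    · rw [repB_mul, h2, hy]
      grind

/-- The longest element of `W(B_n)` acts by `-1`. -/
theorem repB_longest_univ (y : ℕ → ℤ) (hy : ∀ k, n ≤ k → y k = 0) :
    repB n (longest (matB n) Set.univ) y = -y := by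
  obtain ⟨w, -, h⟩ := exists_negation (n := n) 0 n (by omega)
  have hn : ∀ y : ℕ → ℤ, (∀ k, n ≤ k → y k = 0) → repB n w y = -y := by
    intro y hy
    funext k
    rw [h, Pi.neg_apply]
    split_ifs with hk
    · rfl
    · rw [hy k (by omega), neg_zero]
  rw [← eq_longest (w := w) (dom_rhoB n) (by rw [parabolicSubgroup_univ]; trivial), hn y hy]
  rw [hn, neg_neg]
  · exact dom_rhoB n
  · intro k hk
    simp [rhoB, hk]

end TypeB

/-! ### Supports and strict parabolic homomorphisms -/

section Support

variable {B' : Type*} {M' : CoxeterMatrix B'} {n : ℕ}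

/-- The only simple reflection of `B_n` that changes the sum of the first `k + 1` coordinates is
the `k`-th one. -/
theorem sum_reflB {i k : ℕ} (hik : i ≠ k) (hk : k < n) (y : ℕ → ℤ) :
    ∑ j ∈ Finset.range (k + 1), reflB n i y j = ∑ j ∈ Finset.range (k + 1), y j := by
  by_cases h : i < k
  · refine Finset.sum_equiv (Equiv.swap i (i + 1)) (fun j => ?_) (fun j _ => ?_)
    · simp only [Finset.mem_range, Equiv.swap_apply_def]
      grind
    · simp only [reflB, Equiv.swap_apply_def]
      grind
  · refine Finset.sum_congr rfl fun j hj => ?_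
    rw [Finset.mem_range] at hj
    unfold reflB
    grind

theorem sum_repB_proj {J : Set (Fin n)} {k : Fin n} (hk : k ∉ J) {X : ArtinMonoid (matB n)}
    (hX : X ∈ Submonoid.closure (gen (matB n) '' J)) (y : ℕ → ℤ) :
    ∑ j ∈ Finset.range (k + 1), repB n (proj _ X) y j = ∑ j ∈ Finset.range (k + 1), y j := by
  induction hX using Submonoid.closure_induction generalizing y with
  | mem x hx =>
    obtain ⟨i, hi, rfl⟩ := hx
    rw [proj_gen, repB_simple, sum_reflB _ k.2]
    rintro h
    exact hk (Fin.ext h ▸ hi)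
  | one => simp
  | mul a b _ _ ha hb => rw [map_mul, repB_mul, ha, hb]

/-- A homomorphism has full support if some sequence has all its partial sums changed by the
projection of some element of the image. -/
theorem homSupp_univ_eq_univ (Φ : ArtinMonoid M' →* ArtinMonoid (matB n)) (X : ArtinMonoid M')
    (y : ℕ → ℤ) (h : ∀ k < n, ∑ j ∈ Finset.range (k + 1), repB n (proj _ (Φ X)) y j ≠
      ∑ j ∈ Finset.range (k + 1), y j) : homSupp Φ Set.univ = Set.univ := by
  rw [Set.eq_univ_iff_forall]
  intro k
  by_contra hk
  simp only [homSupp, Set.mem_univ, Set.iUnion_true, Set.mem_iUnion, supp, Set.mem_sInter,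
    not_exists, not_forall] at hk
  have hmem : ∀ X, Φ X ∈ Submonoid.closure (gen (matB n) '' {k}ᶜ) := by
    intro X
    obtain ⟨ω, rfl⟩ := wordGen_surjective M' X
    induction ω with
    | nil => simp
    | cons i ω ih =>
      obtain ⟨J, hJ, hkJ⟩ := hk i
      rw [wordGen_cons, map_mul]
      refine mul_mem (Submonoid.closure_mono (Set.image_mono ?_) hJ) ih
      rintro j hj rfl
      exact hkJ hj
  exact h k k.2 (sum_repB_proj (by simp) (hmem X) y)

/-- Every `T_{w_{J;I}}` is mapped to an element of the same form. -/
def MapsParabolic {B : Type*} {M : CoxeterMatrix B} (Φ : ArtinMonoid M' →* ArtinMonoid M) :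
    Prop :=
  ∀ J' : Set B', ∃ J : Set B, Φ (parabolicElt M' J' Set.univ) = parabolicElt M J Set.univ

theorem MapsParabolic.comp {B B'' : Type*} {M : CoxeterMatrix B} {M'' : CoxeterMatrix B''}
    {Ψ : ArtinMonoid M →* ArtinMonoid M''} {Φ : ArtinMonoid M' →* ArtinMonoid M}
    (hΨ : MapsParabolic Ψ) (hΦ : MapsParabolic Φ) : MapsParabolic (Ψ.comp Φ) := by
  intro J'
  obtain ⟨J, hJ⟩ := hΦ J'
  obtain ⟨J₂, hJ₂⟩ := hΨ J
  exact ⟨J₂, by rw [MonoidHom.comp_apply, hJ, hJ₂]⟩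

theorem strictParabolic_of_mapsParabolic {Φ : ArtinMonoid M' →* ArtinMonoid (matB n)}
    (hfin : FiniteType M' Set.univ) (hsupp : homSupp Φ Set.univ = Set.univ)
    (h : MapsParabolic Φ) : StrictParabolic Φ ∧ MapsParabolicElts Φ := by
  refine ⟨fun K' hK' => ?_, hfin, ?_⟩
  · obtain rfl : K' = Set.univ := hK'.eq_of_le hfin (Set.subset_univ _)
    refine ⟨finiteType_matB _, fun J' _ => ?_⟩
    rw [hsupp]
    obtain ⟨J, hJ⟩ := h J'
    exact ⟨J, Set.subset_univ _, hJ⟩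
  · rintro X ⟨-, J', rfl⟩
    exact ⟨finiteType_matB _, h J'⟩

end Support

/-! ### Homomorphisms between Artin monoids of type `B` -/

section Embedding

/-- Data for a homomorphism from type `B_m` to type `B_n`: images `f i` of the simple
reflections, and an equivariant map `E` of sequences under which the simple reflection `i` of `B_m`
corresponds to the simple reflections in `θ i` of `B_n`, while the points `E y` are always
dominant for the simple reflections in `L`. -/
structure BlockEmbedding (m n : ℕ) where
  /-- The images of the simple reflections. -/
  f : Fin m → (matB n).Group
  /-- The map of sequences. -/
  E : (ℕ → ℤ) → ℕ → ℤ
  /-- The simple reflections for which every `E y` is dominant. -/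
  L : Set (Fin n)
  /-- The simple reflections for which dominance of `E y` is inherited from dominance of `y` for a
  given simple reflection of `B_m`. -/
  θ : Fin m → Set (Fin n)
  equivariant : ∀ (i : Fin m) y, repB n (f i) (E y) = E (reflB m i y)
  f_mem : ∀ i, f i ∈ parabolicSubgroup (matB n) (L ∪ θ i)
  dom_L : ∀ y, ∀ j ∈ L, posB n j (E y)
  dom_θ : ∀ y (i : Fin m), posB m i y → ∀ j ∈ θ i, posB n j (E y)
  cover : ∀ j, j ∈ L ∨ ∃ i, j ∈ θ i
  E_of_le : ∀ y k, n ≤ k → E y k = 0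
  /-- As `-E (-ρ)` is `L`-antidominant, `z` is the longest element of `W_L`. -/
  exists_flip : ∃ z ∈ parabolicSubgroup (matB n) L, repB n z (E (rhoB m)) = -E (-rhoB m)

namespace BlockEmbedding

variable {m n : ℕ} (e : BlockEmbedding m n)

theorem dom_E {J' : Set (Fin m)} {y : ℕ → ℤ} (hy : (domB m).Dom J' y) :
    (domB n).Dom (e.L ∪ ⋃ i ∈ J', e.θ i) (e.E y) := by
  rintro j (hj | hj)
  · exact e.dom_L y j hj
  · simp only [Set.mem_iUnion] at hj
    obtain ⟨i, hi, hj⟩ := hj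
    exact e.dom_θ y i (hy i hi) j hj

theorem dom_E_rhoB : (domB n).Dom Set.univ (e.E (rhoB m)) := by
  intro j _
  refine e.dom_E (dom_rhoB m) j ?_
  rcases e.cover j with h | ⟨i, h⟩
  · exact Or.inl h
  · exact Or.inr (by simpa using ⟨i, h⟩)

/-- The Coxeter relations hold for the `f i` because the regular point `E ρ` has trivial
stabilizer. -/
theorem liftable : (matB m).IsLiftable e.f := by
  intro i j
  refine eq_of_repB_eq e.dom_E_rhoB ?_
  have key : ∀ (k : ℕ) (y : ℕ → ℤ), repB n ((e.f i * e.f j) ^ k) (e.E y) =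
      e.E (repB m (((matB m).simple i * (matB m).simple j) ^ k) y) := by
    intro k y
    induction k with
    | zero => simp
    | succ k ih =>
      rw [pow_succ', pow_succ', repB_mul, ih, repB_mul, repB_mul, repB_mul, e.equivariant,
        e.equivariant, repB_simple, repB_simple]
  rw [key, ← CoxeterMatrix.toCoxeterSystem_simple, CoxeterSystem.simple_mul_simple_pow, repB_one,
    repB_one]

/-- The homomorphism of Coxeter groups. -/
def groupHom : (matB m).Group →* (matB n).Group :=
  (matB m).toCoxeterSystem.lift ⟨_, e.liftable⟩

@[simp] theorem groupHom_simple (i : Fin m) : e.groupHom ((matB m).simple i) = e.f i := by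
  have := (matB m).toCoxeterSystem.lift_apply_simple e.liftable i
  rwa [CoxeterMatrix.toCoxeterSystem_simple] at this

theorem repB_groupHom (w : (matB m).Group) (y : ℕ → ℤ) :
    repB n (e.groupHom w) (e.E y) = e.E (repB m w y) := by
  refine (matB m).toCoxeterSystem.simple_induction_left
    (p := fun w => repB n (e.groupHom w) (e.E y) = e.E (repB m w y)) w ?_ fun w i ih => ?_
  · simp
  · rw [CoxeterMatrix.toCoxeterSystem_simple, map_mul, repB_mul, ih, groupHom_simple,
      e.equivariant, repB_mul, repB_simple]

theorem groupHom_mem {J' : Set (Fin m)} {w : (matB m).Group}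
    (hw : w ∈ parabolicSubgroup (matB m) J') :
    e.groupHom w ∈ parabolicSubgroup (matB n) (e.L ∪ ⋃ i ∈ J', e.θ i) := by
  have : parabolicSubgroup (matB m) J' ≤
      (parabolicSubgroup (matB n) (e.L ∪ ⋃ i ∈ J', e.θ i)).comap e.groupHom := by
    rw [parabolicSubgroup, Subgroup.closure_le]
    rintro _ ⟨i, hi, rfl⟩
    rw [SetLike.mem_coe, Subgroup.mem_comap, groupHom_simple]
    refine parabolicSubgroup_mono ?_ (e.f_mem i)
    exact Set.union_subset_union_right _ (Set.subset_biUnion_of_mem (u := e.θ) hi)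
  exact this hw

theorem length_groupHom (w : (matB m).Group) (i : Fin m)
    (h : (matB m).toCoxeterSystem.length w <
      (matB m).toCoxeterSystem.length ((matB m).simple i * w)) :
    (matB n).toCoxeterSystem.length (e.groupHom ((matB m).simple i) * e.groupHom w) =
      (matB n).toCoxeterSystem.length (e.groupHom ((matB m).simple i)) +
        (matB n).toCoxeterSystem.length (e.groupHom w) := by
  have h1 := (domB m).pos_of_length_simple_mul (dom_rhoB m) h
  refine (domB n).length_mul_of_dom (J := e.L ∪ e.θ i) e.dom_E_rhoB
    (by rw [groupHom_simple]; exact e.f_mem i) ?_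
  change (domB n).Dom _ (repB n _ _)
  rw [e.repB_groupHom]
  rintro j (hj | hj)
  · exact e.dom_L _ j hj
  · exact e.dom_θ _ i h1 j hj

theorem E_neg_rhoB_eq : repB n (e.groupHom (longest (matB m) Set.univ)) (e.E (rhoB m)) =
    e.E (-rhoB m) := by
  rw [e.repB_groupHom, repB_longest_univ]
  intro k hk
  simp [rhoB, hk]

theorem exists_longest_mul (J' : Set (Fin m)) :
    ∃ J : Set (Fin n), e.groupHom (longest (matB m) J' * longest (matB m) Set.univ) =
      longest (matB n) J * longest (matB n) Set.univ := by
  obtain ⟨z, hz, hzE⟩ := e.exists_flip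
  refine ⟨e.L ∪ ⋃ i ∈ J', e.θ i, ?_⟩
  have h1 : e.groupHom (longest (matB m) Set.univ) = z * longest (matB n) Set.univ := by
    refine eq_of_repB_eq e.dom_E_rhoB ?_
    rw [e.E_neg_rhoB_eq, repB_mul, repB_longest_univ _ (e.E_of_le _), repB_neg, hzE, neg_neg]
  have h2 : e.groupHom (longest (matB m) J') * z =
      longest (matB n) (e.L ∪ ⋃ i ∈ J', e.θ i) := by
    refine eq_longest e.dom_E_rhoB (mul_mem (e.groupHom_mem (longest_mem J'))
      (parabolicSubgroup_mono Set.subset_union_left hz)) ?_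
    rw [repB_mul, hzE, repB_neg, neg_neg, e.repB_groupHom, repB_neg]
    exact e.dom_E (dom_neg_longest (dom_rhoB m) J')
  rw [map_mul, h1, ← mul_assoc, h2]

theorem exists_artinHom : ∃ Φ : ArtinMonoid (matB m) →* ArtinMonoid (matB n),
    (∀ i, Φ (gen (matB m) i) = lift (matB n) (e.f i)) ∧
    (∀ w, Φ (lift (matB m) w) = lift (matB n) (e.groupHom w)) ∧ MapsParabolic Φ := by
  obtain ⟨Φ, h1, h2⟩ := (domB n).exists_hom (dom_rhoB n) e.groupHom e.length_groupHom
    (fun i j hij _ => (domB m).isReduced_altWord (dom_rhoB m) hij _ fun _ => le_rfl)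
  refine ⟨Φ, fun i => by rw [h1, groupHom_simple], h2, fun J' => ?_⟩
  obtain ⟨J, hJ⟩ := e.exists_longest_mul J'
  exact ⟨J, by rw [parabolicElt, h2, hJ, parabolicElt]⟩

/-- `E (-ρ) < E ρ` coordinatewise (strictly in the first coordinate) forces full support: all
partial sums of `E ρ` are changed by the image of the longest element. -/
theorem homSupp_eq_univ {B' : Type*} {M' : CoxeterMatrix B'}
    {Φ : ArtinMonoid M' →* ArtinMonoid (matB n)} {X : ArtinMonoid M'}
    (hX : Φ X = lift (matB n) (e.groupHom (longest (matB m) Set.univ)))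
    (h0 : e.E (-rhoB m) 0 < e.E (rhoB m) 0) (hle : ∀ k, e.E (-rhoB m) k ≤ e.E (rhoB m) k) :
    homSupp Φ Set.univ = Set.univ := by
  refine homSupp_univ_eq_univ Φ X (e.E (rhoB m)) fun k _ => ?_
  rw [hX, proj_lift, e.E_neg_rhoB_eq]
  exact (Finset.sum_lt_sum (fun i _ => hle i) ⟨0, by simp, h0⟩).ne

end BlockEmbedding

end Embedding

/-! ### Unfolding the last node of type `B` -/

section Unfolding

/-- The standard embedding of type `B_m` in type `B_n`: the generators `s_1, …, s_{m-1}` are kept,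
and the sign change of the last coordinate of `B_m` is that of the `m`-th coordinate of `B_n`. -/
def standardEmbedding (m n : ℕ) (hm : 1 ≤ m) (hmn : m ≤ n) : BlockEmbedding m n where
  f i := if (i : ℕ) + 1 < m then (matB n).simple ⟨i, by omega⟩ else proj _ (palindromeB n m)
  -- the factor `n` makes the first `m` coordinates larger than the remaining ones
  E y k := if k < m then n * y k else if k < n then n - k else 0
  L := {j | m ≤ (j : ℕ)}
  θ i := {j | (j : ℕ) = i}
  equivariant i y := by
    funext k
    have := i.2
    by_cases hi : (i : ℕ) + 1 < m
    · rw [if_pos hi, repB_simple]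
      simp only [reflB]
      split_ifs <;> first | rfl | omega
    · rw [if_neg hi, (palindromeB_spec (n - m) m hm (by omega)).2.1]
      simp only [reflB]
      split_ifs <;> first | rfl | omega | simp
  f_mem i := by
    have := i.2
    split_ifs with hi
    · exact simple_mem_parabolicSubgroup (Or.inr rfl)
    · refine parabolicSubgroup_mono ?_ (palindromeB_spec (n - m) m hm (by omega)).1
      intro j hj
      simp only [Set.mem_ofPred_eq, Set.mem_union] at hj ⊢
      omega
  dom_L y j hj := by
    have := j.2
    simp only [Set.mem_ofPred_eq] at hj
    unfold posB
    grind
  dom_θ y i hi j hj := by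
    simp only [Set.mem_ofPred_eq] at hj
    have hi2 := i.2
    have hj2 := j.2
    unfold posB at hi ⊢
    rw [hj]
    have hn : (0 : ℤ) < n := by omega
    split_ifs at hi with h1
    · have h2 : (n : ℤ) * 1 ≤ n * y i := by
        apply mul_le_mul_of_nonneg_left _ hn.le
        omega
      grind
    · simp only [if_neg (show ¬ (i : ℕ) + 1 = n by omega), if_pos (show (i : ℕ) + 1 < m by omega),
        if_pos hi2]
      exact mul_lt_mul_of_pos_left hi hn
  cover j := by
    by_cases h : m ≤ (j : ℕ)
    · exact Or.inl h
    · exact Or.inr ⟨⟨j, by omega⟩, rfl⟩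
  E_of_le y k hk := by
    rw [if_neg (by omega), if_neg (by omega)]
  exists_flip := by
    obtain ⟨w, hw, hy⟩ := exists_negation (n := n) m (n - m) (by omega)
    refine ⟨w, hw, ?_⟩
    funext k
    rw [hy]
    simp only [Pi.neg_apply]
    split_ifs <;> first | omega | simp

end Unfolding

/-! ### Cabling -/

section Cabling

variable {n : ℕ}

theorem repB_longest_interval {a l : ℕ} (h : a + l < n) (y : ℕ → ℤ) (k : ℕ) :
    repB n (longest (matB n) (intervalB n (a + 1) (a + l))) y k =
      if a ≤ k ∧ k ≤ a + l then y (2 * a + l - k) else y k := by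
  obtain ⟨w, hw, hy⟩ := exists_reversal (n := n) a l h
  rw [← eq_longest (w := w) (dom_rhoB n) (parabolicSubgroup_mono ?_ hw), hy]
  · intro j hj
    simp only [intervalB, Set.mem_ofPred_eq] at hj
    change posB n j _
    unfold posB
    rw [if_neg (by omega)]
    simp only [Pi.neg_apply, hy, rhoB]
    rw [if_pos (by omega), if_pos (by omega)]
    omega
  · intro j hj
    simp only [intervalB, Set.mem_ofPred_eq] at hj ⊢
    omega

theorem repB_longest_interval_union {a l b l' : ℕ} (h : a + l < b) (h' : b + l' < n)
    (y : ℕ → ℤ) (k : ℕ) :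
    repB n (longest (matB n) (intervalB n (a + 1) (a + l) ∪ intervalB n (b + 1) (b + l'))) y k =
      if a ≤ k ∧ k ≤ a + l then y (2 * a + l - k)
      else if b ≤ k ∧ k ≤ b + l' then y (2 * b + l' - k) else y k := by
  obtain ⟨w, hw, hy⟩ := exists_reversal (n := n) a l (by omega)
  obtain ⟨v, hv, hz⟩ := exists_reversal (n := n) b l' h'
  have key : ∀ (y : ℕ → ℤ) (k : ℕ), repB n (w * v) y k =
      if a ≤ k ∧ k ≤ a + l then y (2 * a + l - k)
      else if b ≤ k ∧ k ≤ b + l' then y (2 * b + l' - k) else y k := by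
    intro y k
    rw [repB_mul, hy, hz, hz]
    grind
  rw [← eq_longest (w := w * v) (dom_rhoB n) (mul_mem (parabolicSubgroup_mono ?_ hw)
    (parabolicSubgroup_mono ?_ hv)), key]
  · intro j hj
    simp only [intervalB, Set.mem_ofPred_eq, Set.mem_union] at hj
    change posB n j _
    unfold posB
    rw [if_neg (by omega)]
    simp only [Pi.neg_apply, key, rhoB]
    split_ifs <;> omega
  · intro j hj
    simp only [intervalB, Set.mem_ofPred_eq, Set.mem_union] at hj ⊢
    omega
  · intro j hj
    simp only [intervalB, Set.mem_ofPred_eq, Set.mem_union] at hj ⊢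
    omega

theorem repB_longest_tail {a : ℕ} (h : a < n) (y : ℕ → ℤ) (k : ℕ) :
    repB n (longest (matB n) (intervalB n (a + 1) n)) y k =
      if a ≤ k ∧ k < n then -y k else y k := by
  obtain ⟨w, hw, hy⟩ := exists_negation (n := n) a (n - a) (by omega)
  rw [← eq_longest (w := w) (dom_rhoB n) (parabolicSubgroup_mono ?_ hw), hy]
  · intro j hj
    simp only [intervalB, Set.mem_ofPred_eq] at hj
    change posB n j _
    unfold posB
    simp only [Pi.neg_apply, hy, rhoB]
    grind
  · intro j hj
    have := j.2
    simp only [intervalB, Set.mem_ofPred_eq] at hj ⊢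
    omega

/-- `w_{J;K}` for two adjacent blocks of size `m` swaps the blocks. -/
theorem repB_blockSwap {a m : ℕ} (hm : 1 ≤ m) (h : a + 2 * m ≤ n) (y : ℕ → ℤ) (k : ℕ) :
    repB n (longest (matB n) (intervalB n (a + 1) (a + m - 1) ∪
        intervalB n (a + m + 1) (a + 2 * m - 1)) *
      longest (matB n) (intervalB n (a + 1) (a + 2 * m - 1))) y k =
      if a ≤ k ∧ k < a + m then y (k + m)
      else if a + m ≤ k ∧ k < a + 2 * m then y (k - m) else y k := by
  have h1 := repB_longest_interval_union (n := n) (a := a) (l := m - 1) (b := a + m) (l' := m - 1)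
    (by omega) (by omega)
  have h2 := repB_longest_interval (n := n) (a := a) (l := 2 * m - 1) (by omega)
  rw [show a + (m - 1) = a + m - 1 by omega, show a + m + (m - 1) = a + 2 * m - 1 by omega] at h1
  rw [show a + (2 * m - 1) = a + 2 * m - 1 by omega] at h2
  rw [repB_mul, h1, h2, h2, h2]
  grind

/-- `w_{J;K}` for the last block of size `m` reverses and negates the block. -/
theorem repB_blockFlip {a m : ℕ} (hm : 1 ≤ m) (h : a + m = n) (y : ℕ → ℤ) (k : ℕ) :
    repB n (longest (matB n) (intervalB n (a + 1) (n - 1)) *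
      longest (matB n) (intervalB n (a + 1) n)) y k =
      if a ≤ k ∧ k < n then -y (2 * a + m - 1 - k) else y k := by
  have h1 := repB_longest_interval (n := n) (a := a) (l := m - 1) (by omega)
  rw [show a + (m - 1) = n - 1 by omega] at h1
  rw [repB_mul, h1, repB_longest_tail (by omega), repB_longest_tail (by omega)]
  grind

/-- The map of sequences that replaces each coordinate by a block of `m` coordinates, decreasing by
steps of `2` and centered at `2 m` times the coordinate. -/
def cableSeq (m n : ℕ) (y : ℕ → ℤ) (k : ℕ) : ℤ :=
  if k < m * n then 2 * m * y (k / m) + (m - 1 - 2 * ((k % m : ℕ) : ℤ)) else 0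

theorem mul_add_lt_mul_iff {m q r s : ℕ} (hr : r < m) : q * m + r < s * m ↔ q < s := by
  rw [← Nat.div_lt_iff_lt_mul (by omega), mul_comm q, Nat.mul_add_div (by omega),
    Nat.div_eq_of_lt hr, add_zero]

theorem cableSeq_apply {m n q r : ℕ} (hr : r < m) (hq : q < n) (y : ℕ → ℤ) :
    cableSeq m n y (q * m + r) = 2 * m * y q + (m - 1 - 2 * (r : ℤ)) := by
  rw [cableSeq, if_pos (by rw [mul_comm m]; exact (mul_add_lt_mul_iff hr).2 hq), mul_comm q,
    Nat.mul_add_div (by omega), Nat.div_eq_of_lt hr, Nat.mul_add_mod, Nat.mod_eq_of_lt hr, add_zero]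

theorem cableSeq_of_le {m n k : ℕ} (hk : m * n ≤ k) (y : ℕ → ℤ) : cableSeq m n y k = 0 := by
  rw [cableSeq, if_neg (by omega)]

theorem exists_eq_mul_add {m n k : ℕ} (hm : 1 ≤ m) (hk : k < m * n) :
    ∃ q r, q < n ∧ r < m ∧ k = q * m + r :=
  ⟨k / m, k % m, Nat.div_lt_of_lt_mul hk, Nat.mod_lt _ (by omega), (Nat.div_add_mod' k m).symm⟩

/-- The simultaneous reversal of the first `A` blocks of size `m`. -/
theorem exists_blockReversal {m : ℕ} (hm : 1 ≤ m) (A : ℕ) (hA : A * m ≤ n) :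
    ∃ z ∈ parabolicSubgroup (matB n) {j : Fin n | ((j : ℕ) + 1) % m ≠ 0}, ∀ y q r, r < m →
      repB n z y (q * m + r) = if q < A then y (q * m + (m - 1 - r)) else y (q * m + r) := by
  induction A with
  | zero => exact ⟨1, one_mem _, fun y q r _ => by rw [repB_one, if_neg (by omega)]⟩
  | succ A ih =>
    have hA' : A * m + m ≤ n := by rwa [← Nat.succ_mul]
    obtain ⟨z, hz, hzy⟩ := ih (by omega)
    obtain ⟨w, hw, hwy⟩ := exists_reversal (n := n) (A * m) (m - 1) (by omega)
    refine ⟨w * z, mul_mem (parabolicSubgroup_mono ?_ hw) hz, fun y q r hr => ?_⟩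
    · intro j hj
      simp only [Set.mem_ofPred_eq] at hj ⊢
      obtain ⟨c, hc⟩ : ∃ c, (j : ℕ) + 1 = m * A + c := ⟨j + 1 - A * m, by rw [mul_comm]; omega⟩
      rw [mul_comm A] at hj
      rw [hc, Nat.mul_add_mod, Nat.mod_eq_of_lt (by omega)]
      omega
    · rw [repB_mul, hwy]
      have h1 := mul_add_lt_mul_iff (q := q) (s := A) hr
      have h2 := mul_add_lt_mul_iff (q := q) (s := A + 1) hr
      rw [Nat.succ_mul] at h2
      rcases lt_trichotomy q A with hq | rfl | hq
      · rw [if_neg (by omega), hzy _ _ _ hr, if_pos hq, if_pos (by omega)]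
      · rw [if_pos (by omega),
          show 2 * (q * m) + (m - 1) - (q * m + r) = q * m + (m - 1 - r) by omega,
          hzy _ _ _ (by omega), if_neg (by omega), if_pos (by omega)]
      · rw [if_neg (by omega), hzy _ _ _ hr, if_neg (by omega), if_neg (by omega)]

/-- The elements `w_{J;K}` that are the images of the simple reflections under cabling. -/
def cableElt (m n i : ℕ) : (matB (m * n)).Group :=
  if i + 1 < n then
    longest (matB (m * n)) (intervalB (m * n) (i * m + 1) (i * m + m - 1) ∪
        intervalB (m * n) (i * m + m + 1) (i * m + 2 * m - 1)) *
      longest (matB (m * n)) (intervalB (m * n) (i * m + 1) (i * m + 2 * m - 1))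
  else longest (matB (m * n)) (intervalB (m * n) (i * m + 1) (m * n - 1)) *
    longest (matB (m * n)) (intervalB (m * n) (i * m + 1) (m * n))

theorem repB_cableElt {m n i : ℕ} (hm : 1 ≤ m) (hi : i < n) (y : ℕ → ℤ) :
    repB (m * n) (cableElt m n i) (cableSeq m n y) = cableSeq m n (reflB n i y) := by
  funext k
  by_cases hk : m * n ≤ k
  · rw [repB_of_le _ _ hk, cableSeq_of_le hk, cableSeq_of_le hk]
  obtain ⟨q, r, hq, hr, rfl⟩ := exists_eq_mul_add hm (not_le.1 hk)
  have h0 := mul_add_lt_mul_iff (q := q) (s := i) hr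
  have h1 := mul_add_lt_mul_iff (q := q) (s := i + 1) hr
  have h2 := mul_add_lt_mul_iff (q := q) (s := i + 1 + 1) hr
  rw [Nat.succ_mul] at h1
  rw [Nat.succ_mul, Nat.succ_mul] at h2
  rw [cableSeq_apply hr hq, cableElt]
  by_cases hlast : i + 1 < n
  · have hle : (i + 1 + 1) * m ≤ m * n := by
      rw [mul_comm m]; exact Nat.mul_le_mul_right m (by omega)
    rw [Nat.succ_mul, Nat.succ_mul] at hle
    rw [if_pos hlast, repB_blockSwap hm (by omega)]
    unfold reflB
    rw [if_neg (show ¬ i + 1 = n by omega)]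
    by_cases hq1 : q = i
    · subst hq1
      rw [if_pos (by omega), if_pos rfl,
        show q * m + r + m = (q + 1) * m + r by rw [Nat.succ_mul]; omega,
        cableSeq_apply hr (by omega)]
    · by_cases hq2 : q = i + 1
      · subst hq2
        rw [if_neg (by omega), if_pos (by omega), if_neg hq1, if_pos rfl,
          show (i + 1) * m + r - m = i * m + r by rw [Nat.succ_mul]; omega,
          cableSeq_apply hr (by omega)]
      · rw [if_neg (by omega), if_neg (by omega), if_neg hq1, if_neg hq2, cableSeq_apply hr hq]
  · have hin : n = i + 1 := by omega
    have hle : i * m + m = m * n := by rw [hin, mul_comm m, Nat.succ_mul]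
    rw [if_neg hlast, repB_blockFlip hm hle]
    unfold reflB
    rw [if_pos hin.symm]
    by_cases hq1 : q = i
    · subst hq1
      rw [if_pos (by omega), if_pos rfl,
        show 2 * (q * m) + m - 1 - (q * m + r) = q * m + (m - 1 - r) by omega,
        cableSeq_apply (by omega) hq, Nat.cast_sub (by omega), Nat.cast_sub (by omega)]
      push_cast
      ring
    · rw [if_neg (by omega), if_neg hq1, cableSeq_apply hr hq]

/-- Replacing every coordinate by a block of `m` coordinates. -/
def cableEmbedding (m n : ℕ) (hm : 1 ≤ m) : BlockEmbedding n (m * n) where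
  f i := cableElt m n i
  E := cableSeq m n
  L := {j | ((j : ℕ) + 1) % m ≠ 0}
  θ i := {j | (j : ℕ) + 1 = (i + 1) * m}
  equivariant i y := repB_cableElt hm i.2 y
  f_mem i := by
    have hi := i.2
    -- among the nodes of the two blocks only the middle one separates blocks
    have hmod : ∀ j : ℕ, (i : ℕ) * m ≤ j → j + 1 < i * m + 2 * m →
        (j + 1) % m ≠ 0 ∨ j + 1 = (i + 1) * m := by
      intro j h1 h2
      by_contra hcon
      push Not at hcon
      obtain ⟨c, hc⟩ := Nat.dvd_of_mod_eq_zero hcon.1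
      have h3 : (i : ℕ) < c := by
        by_contra h
        have := Nat.mul_le_mul_left m (not_lt.1 h)
        rw [mul_comm m i] at this
        omega
      have h4 : c < i + 2 := by
        by_contra h
        have := Nat.mul_le_mul_left m (not_lt.1 h)
        rw [mul_comm m (i + 2), add_mul] at this
        omega
      exact hcon.2 (by rw [hc, show c = i + 1 by omega, mul_comm])
    have hle : ((i : ℕ) + 1) * m ≤ m * n := by
      rw [mul_comm m]; exact Nat.mul_le_mul_right m hi
    unfold cableElt
    split_ifs with h
    · refine mul_mem (parabolicSubgroup_mono ?_ (longest_mem _))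
        (parabolicSubgroup_mono ?_ (longest_mem _)) <;>
      · intro j hj
        simp only [intervalB, Set.mem_ofPred_eq, Set.mem_union] at hj ⊢
        exact hmod j (by omega) (by omega)
    · rw [Nat.succ_mul] at hle
      have hle' : m * n = i * m + m := by
        rw [← Nat.succ_mul, mul_comm m]
        exact congrArg (· * m) (show n = i + 1 by omega)
      refine mul_mem (parabolicSubgroup_mono ?_ (longest_mem _))
        (parabolicSubgroup_mono ?_ (longest_mem _)) <;>
      · intro j hj
        simp only [intervalB, Set.mem_ofPred_eq, Set.mem_union] at hj ⊢
        exact hmod j (by omega) (by omega)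
  dom_L y j hj := by
    simp only [Set.mem_ofPred_eq] at hj
    have hj2 := j.2
    obtain ⟨q, r, hq, hr, hjq⟩ := exists_eq_mul_add hm hj2
    have hr1 : r + 1 < m := by
      by_contra h
      apply hj
      rw [hjq, show q * m + r + 1 = (q + 1) * m by rw [Nat.succ_mul]; omega, Nat.mul_mod_left]
    have hlt := (mul_add_lt_mul_iff (q := q) (s := n) hr1).2 hq
    unfold posB
    rw [mul_comm n] at hlt
    rw [hjq, if_neg (by omega), add_assoc, cableSeq_apply hr1 hq, cableSeq_apply hr hq]
    push_cast
    omega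
  dom_θ y i hi j hj := by
    simp only [Set.mem_ofPred_eq] at hj
    have hi2 := i.2
    have hj1 : (j : ℕ) = i * m + (m - 1) := by
      rw [Nat.succ_mul] at hj; omega
    unfold posB at hi ⊢
    have hm0 : (0 : ℤ) < 2 * m := by omega
    split_ifs at hi with h
    · rw [if_pos (by rw [hj, h, mul_comm]), hj1, cableSeq_apply (by omega) hi2,
        Nat.cast_sub hm]
      have h2 : (2 * m : ℤ) * 1 ≤ 2 * m * y i :=
        mul_le_mul_of_nonneg_left (by omega) hm0.le
      push_cast
      omega
    · have h3 : ¬ (j : ℕ) + 1 = m * n := by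
        rw [hj, mul_comm m]
        intro h'
        exact h (Nat.eq_of_mul_eq_mul_right (by omega) h')
      have h4 := cableSeq_apply (m := m) (n := n) (q := i + 1) (r := 0) (by omega) (by omega) y
      rw [add_zero] at h4
      rw [if_neg h3, hj, h4, hj1, cableSeq_apply (by omega) hi2, Nat.cast_sub hm]
      have h2 : (2 * m : ℤ) * (y (i + 1) + 1) ≤ 2 * m * y i :=
        mul_le_mul_of_nonneg_left (by omega) hm0.le
      rw [mul_add] at h2
      push_cast
      omega
  cover j := by
    by_cases h : ((j : ℕ) + 1) % m = 0
    · obtain ⟨q, r, hq, hr, hjq⟩ := exists_eq_mul_add hm j.2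
      refine Or.inr ⟨⟨q, hq⟩, ?_⟩
      have hr1 : r + 1 = m := by
        by_contra hcon
        rw [hjq, add_assoc, mul_comm q, Nat.mul_add_mod, Nat.mod_eq_of_lt (by omega)] at h
        omega
      simp only [Set.mem_ofPred_eq]
      rw [hjq, Nat.succ_mul]
      omega
    · exact Or.inl h
  E_of_le y k hk := cableSeq_of_le hk y
  exists_flip := by
    obtain ⟨z, hz, hzy⟩ := exists_blockReversal (n := m * n) hm n (by rw [mul_comm])
    refine ⟨z, hz, ?_⟩
    funext k
    by_cases hk : m * n ≤ k
    · rw [repB_of_le _ _ hk, Pi.neg_apply, cableSeq_of_le hk, cableSeq_of_le hk, neg_zero]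
    obtain ⟨q, r, hq, hr, rfl⟩ := exists_eq_mul_add hm (not_le.1 hk)
    rw [hzy _ _ _ hr, if_pos hq, Pi.neg_apply, cableSeq_apply (by omega) hq, cableSeq_apply hr hq,
      Nat.cast_sub (by omega), Nat.cast_sub hm, Pi.neg_apply]
    push_cast
    ring

end Cabling

/-! ### Dihedral groups -/

section Dihedral

theorem longest_singleton {B : Type*} {M : CoxeterMatrix B} {i : B} (h : FiniteType M {i}) :
    longest M {i} = M.simple i := by
  obtain ⟨ω, hω, hw⟩ := exists_minWord_of_mem (longest_mem (M := M) {i})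
  have h1 := length_le_length_longest h (simple_mem_parabolicSubgroup (Set.mem_singleton i))
  rw [← CoxeterMatrix.toCoxeterSystem_simple, CoxeterSystem.length_simple] at h1
  match ω, hω with
  | [], _ =>
    rw [← hw] at h1
    simp at h1
  | [a], hω =>
    obtain rfl : a = i := hω.1 a (by simp)
    rw [← hw, CoxeterSystem.wordProd_singleton]
    rfl
  | a :: b :: ω, hω =>
    obtain rfl : a = i := hω.1 a (by simp)
    obtain rfl : b = a := hω.1 b (by simp)
    exact absurd hω not_minWord_cons_self

variable (m : ℕ)

theorem matI_apply_of_ne (hm : 1 ≤ m) {i j : Fin 2} (h : i ≠ j) : matI m i j = 2 * m := by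
  change (if i = j then 1 else 2 * m - 2 + 2) = _
  rw [if_neg h]
  omega

theorem exists_altWord_of_isReduced (hm : 1 ≤ m) {ω : List (Fin 2)}
    (h : (matI m).toCoxeterSystem.IsReduced ω) :
    ∃ (i j : Fin 2) (t : ℕ), i ≠ j ∧ t ≤ 2 * m ∧ ω = altWord i j t := by
  induction ω with
  | nil => exact ⟨0, 1, 0, by decide, by omega, rfl⟩
  | cons k ω ih =>
    have h' := minWord_univ.2 h
    obtain ⟨i, j, t, hij, ht, rfl⟩ := ih (minWord_univ.1 h'.tail)
    rcases Nat.eq_zero_or_pos t with rfl | ht0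
    · exact ⟨k, k + 1, 1, by fin_cases k <;> decide, by omega, rfl⟩
    · obtain ⟨q, rfl⟩ : ∃ q, t = q + 1 := ⟨t - 1, by omega⟩
      have hki : k ≠ i := by
        rintro rfl
        exact not_minWord_cons_self h'
      obtain rfl : k = j := by fin_cases k <;> fin_cases i <;> fin_cases j <;> simp_all
      refine ⟨k, i, q + 1 + 1, hki, ?_, rfl⟩
      -- a word with `2 m + 1` letters is not reduced, by the braid relation
      by_contra hlt
      have hq : q + 1 = matI m i k := by
        rw [matI_apply_of_ne m hm hij]; omega
      have h1 := wordProd_braid (matI m) i k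
      rw [← hq] at h1
      have h2 : (matI m).toCoxeterSystem.wordProd (k :: altWord i k (q + 1)) =
          (matI m).toCoxeterSystem.wordProd (k :: altWord k i (q + 1)) := by
        rw [CoxeterSystem.wordProd_cons, h1, CoxeterSystem.wordProd_cons]
      exact not_minWord_cons_self (h'.congr (by simp) h2.symm (by simp))

theorem exists_altWord_eq (hm : 1 ≤ m) (w : (matI m).Group) :
    ∃ (i j : Fin 2) (t : ℕ), i ≠ j ∧ t ≤ 2 * m ∧
      (matI m).toCoxeterSystem.IsReduced (altWord i j t) ∧
      w = (matI m).toCoxeterSystem.wordProd (altWord i j t) := by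
  obtain ⟨ω, hω, rfl⟩ := (matI m).toCoxeterSystem.exists_isReduced w
  obtain ⟨i, j, t, hij, ht, rfl⟩ := exists_altWord_of_isReduced m hm hω
  exact ⟨i, j, t, hij, ht, hω, rfl⟩

theorem finiteType_matI (hm : 1 ≤ m) (J : Set (Fin 2)) : FiniteType (matI m) J := by
  refine finiteType_of_univ (Set.Finite.subset (Set.finite_range
    fun x : Fin 2 × Fin 2 × Fin (2 * m + 1) =>
      (matI m).toCoxeterSystem.wordProd (altWord x.1 x.2.1 x.2.2)) ?_) J
  rintro w -
  obtain ⟨i, j, t, -, ht, -, rfl⟩ := exists_altWord_eq m hm w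
  exact ⟨(i, j, ⟨t, by omega⟩), rfl⟩

end Dihedral

/-! ### The bipartite Coxeter element of type `B` -/

section Bipartite

theorem stepDownB_spec {n : ℕ} (r : ℕ) (hr : r ≤ n) :
    proj _ (stepDownB n r) ∈
      parabolicSubgroup (matB n) {a : Fin n | (a : ℕ) + 1 ≤ r ∧ (r + a + 1) % 2 = 0} ∧
    (∀ y a, repB n (proj _ (stepDownB n r)) y a =
      if a + 1 ≤ r ∧ (r + a + 1) % 2 = 0 then (if a + 1 = n then -y a else y (a + 1))
      else if 1 ≤ a ∧ a ≤ r ∧ a < n ∧ (r + a) % 2 = 0 then y (a - 1) else y a) ∧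
    ∀ w : (matB n).Group,
      (∀ a, a + 1 ≤ r → (r + a + 1) % 2 = 0 → posB n a (repB n w (rhoB n))) →
      (matB n).toCoxeterSystem.length (proj _ (stepDownB n r) * w) =
        length _ (stepDownB n r) + (matB n).toCoxeterSystem.length w := by
  induction r using Nat.strong_induction_on with
  | _ r ih =>
    match r with
    | 0 =>
      simp only [stepDownB, map_one, length_one, one_mul, zero_add, implies_true, and_true]
      refine ⟨one_mem _, fun y a => ?_⟩
      simp
      omega
    | 1 =>
      simp only [stepDownB]
      refine ⟨?_, fun y a => ?_, fun w hw => ?_⟩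
      · rw [genB_of_le le_rfl hr, proj_gen]
        exact simple_mem_parabolicSubgroup (by simp)
      · rw [repB_genB le_rfl hr]
        unfold reflB
        grind
      · rw [genB_of_le le_rfl hr, proj_gen, length_gen, length_simple_mul_of_posB, add_comm]
        exact hw 0 le_rfl rfl
    | r + 2 =>
      obtain ⟨h1, h2, h3⟩ := ih r (by omega) (by omega)
      simp only [stepDownB, map_mul]
      refine ⟨mul_mem ?_ (parabolicSubgroup_mono ?_ h1), fun y a => ?_, fun w hw => ?_⟩
      · rw [genB_of_le (by omega) hr, proj_gen]
        refine simple_mem_parabolicSubgroup ?_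
        simp only [Set.mem_ofPred_eq]
        omega
      · intro a ha
        simp only [Set.mem_ofPred_eq] at ha ⊢
        omega
      · rw [Equiv.Perm.mul_apply, repB_genB (by omega) hr]
        simp only [reflB, h2]
        grind
      · have h4 := h3 w fun a ha hp => hw a (by omega) (by omega)
        rw [mul_assoc, genB_of_le (by omega) hr, proj_gen, length_simple_mul_of_posB, h4,
          length_mul, length_gen]
        · omega
        · have h5 := hw (r + 1) le_rfl (by omega)
          rw [repB_mul]
          unfold posB at h5 ⊢
          simp only [h2]
          grind

variable (m : ℕ)

/-- The two products of commuting generators: `T_m T_{m-2} ⋯` for `i = 0` and `T_{m-1} T_{m-3} ⋯`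
for `i = 1`. -/
def halfB (i : Fin 2) : ArtinMonoid (matB m) := stepDownB m (m - i)

/-- The value of the particle with phase `u` in the billiard, where the phase is position minus time
along the unfolded trajectory. It is determined by the starting sequence `ρ` for `-m < u ≤ m` and
changes sign under translation by `2 m`; only the phases in `(-3 m, m]` occur. -/
def tent (u : ℤ) : ℤ :=
  if 0 < u then m + 1 - u else if -(m : ℤ) < u then m + u
  else if -(2 * m : ℤ) < u then u + m - 1 else -(3 * m) - u

/-- The image of `ρ` under the alternating product of `t` factors `halfB`, when the next factor
is `halfB j`. The coordinates move at unit speed to the right or to the left, according to parity.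
They are reflected at the first position and reflected with a change of sign at the last one. -/
def billiard (j t : ℕ) (a : ℕ) : ℤ :=
  if a < m then
    if (a + 1 + m + j) % 2 = 0 then tent m (a + 1 - t) else tent m (-a - t)
  else 0

theorem billiard_zero (j : ℕ) : billiard m j 0 = rhoB m := by
  funext a
  simp only [billiard, tent, rhoB]
  split_ifs <;> omega

theorem billiard_two_mul (j : ℕ) : billiard m j (2 * m) = -rhoB m := by
  funext a
  simp only [billiard, tent, rhoB, Pi.neg_apply]
  split_ifs <;> omega

theorem posB_billiard {j t a : ℕ} (ht : t < 2 * m) (hj : j ≤ 1) (ha : a + 1 ≤ m - j)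
    (hp : (m - j + a + 1) % 2 = 0) : posB m a (billiard m j t) := by
  simp only [posB, billiard, tent]
  split_ifs <;> omega

theorem tent_sub_two_mul {u : ℤ} (h1 : -m < u) (h2 : u ≤ m) :
    tent m (u - 2 * m) = -tent m u := by
  simp only [tent]
  split_ifs <;> omega

theorem repB_halfB_billiard {i j : Fin 2} {t : ℕ} (hij : i ≠ j) (ht : t < 2 * m) :
    repB m (proj _ (halfB m j)) (billiard m j t) = billiard m i (t + 1) := by
  have hij' : (i : ℕ) = 1 - j := by
    fin_cases i <;> fin_cases j <;> simp_all
  have hj : (j : ℕ) ≤ 1 := by omega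
  funext a
  rw [halfB, (stepDownB_spec _ (Nat.sub_le m j)).2.1, hij']
  generalize (j : ℕ) = j at hj
  unfold billiard
  by_cases ha : a < m
  · rw [if_pos ha]
    split_ifs with k1 k2 <;> try omega
    all_goals first
      -- a particle moves on without a change of sign
      | (refine congrArg (tent m) ?_; omega)
      -- the particle at the last position is reflected
      | (rw [← tent_sub_two_mul m (by omega) (by omega)]; refine congrArg (tent m) ?_; omega)
  · rw [if_neg (by omega), if_neg (by omega), if_neg ha, if_neg ha]

theorem repB_halfB_halfB (i : Fin 2) (y : ℕ → ℤ) :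
    repB m (proj _ (halfB m i) * proj _ (halfB m i)) y = y := by
  funext a
  rw [repB_mul, halfB]
  have h := (stepDownB_spec _ (Nat.sub_le m i)).2.1
  simp only [h]
  grind

/-- Alternating products of at most `2 m` factors `halfB` are square free, because each new factor
moves the billiard away from the dominant chamber. -/
theorem squareFree_prod_altWord {i j : Fin 2} (hij : i ≠ j) {t : ℕ} (ht : t ≤ 2 * m) :
    SquareFree _ ((altWord i j t).map (halfB m)).prod ∧
    repB m (proj _ ((altWord i j t).map (halfB m)).prod) (rhoB m) = billiard m j t := by
  induction t generalizing i j with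
  | zero =>
    simp only [altWord, List.map_nil, List.prod_nil]
    exact ⟨squareFree_one, by rw [map_one, repB_one, billiard_zero]⟩
  | succ t ih =>
    obtain ⟨h1, h2⟩ := ih hij.symm (by omega)
    have h3 := (stepDownB_spec _ (Nat.sub_le m i)).2.2
    rw [altWord, List.map_cons, List.prod_cons]
    constructor
    · rw [SquareFree, map_mul, length_mul, ← h1, halfB]
      apply h3
      intro a ha hp
      rw [h2]
      exact posB_billiard m (by omega) (by omega) ha hp
    · rw [map_mul, repB_mul, h2, repB_halfB_billiard m hij.symm (by omega)]

theorem squareFree_halfB (hm : 1 ≤ m) (i : Fin 2) : SquareFree _ (halfB m i) := by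
  have := (squareFree_prod_altWord m (i := i) (j := i + 1) (by fin_cases i <;> decide)
    (t := 1) (by omega)).1
  simpa [altWord] using this

theorem halfB_liftable (hm : 1 ≤ m) :
    (matI m).IsLiftable fun i => proj _ (halfB m i) := by
  intro i j
  refine eq_of_repB_eq (dom_rhoB m) ?_
  rw [repB_one]
  by_cases hij : i = j
  · subst hij
    rw [(matI m).diagonal, pow_one, repB_halfB_halfB]
  · have h := (squareFree_prod_altWord m hij (t := 2 * m) le_rfl).2
    rw [map_list_prod, List.map_map, prod_map_altWord, billiard_two_mul, brd,
      Nat.mul_div_cancel_left _ two_pos, Nat.mul_mod_right, pow_zero, mul_one] at h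
    rw [matI_apply_of_ne m hm hij, two_mul, pow_add, repB_mul]
    simp only [Function.comp_apply] at h
    rw [h, repB_neg, h, neg_neg]

/-- The homomorphism from the dihedral group to the Coxeter group of type `B_m`. -/
def dihedralHom (hm : 1 ≤ m) : (matI m).Group →* (matB m).Group :=
  (matI m).toCoxeterSystem.lift ⟨_, halfB_liftable m hm⟩

theorem dihedralHom_simple (hm : 1 ≤ m) (i : Fin 2) :
    dihedralHom m hm ((matI m).simple i) = proj _ (halfB m i) := by
  have := (matI m).toCoxeterSystem.lift_apply_simple (halfB_liftable m hm) i
  rwa [CoxeterMatrix.toCoxeterSystem_simple] at this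

theorem dihedralHom_wordProd (hm : 1 ≤ m) (ω : List (Fin 2)) :
    dihedralHom m hm ((matI m).toCoxeterSystem.wordProd ω) =
      proj _ (ω.map (halfB m)).prod := by
  induction ω with
  | nil => simp
  | cons i ω ih =>
    rw [CoxeterSystem.wordProd_cons, map_mul, ih, List.map_cons, List.prod_cons, map_mul,
      CoxeterMatrix.toCoxeterSystem_simple, dihedralHom_simple]

theorem billiard_ne (hm : 2 ≤ m) {j t : ℕ} (hj : j ≤ 1) (ht : t < 2 * m) :
    billiard m j t ≠ -rhoB m := by
  intro h
  have := posB_billiard m ht hj (a := m - j - 1) (by omega) (by omega)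
  rw [h] at this
  simp only [posB, rhoB, Pi.neg_apply] at this
  split_ifs at this <;> omega

theorem isReduced_altWord_matI (hm : 2 ≤ m) {i j : Fin 2} (hij : i ≠ j) :
    (matI m).toCoxeterSystem.IsReduced (altWord i j (2 * m)) := by
  obtain ⟨i', j', t, hij', ht, hred, hw⟩ := exists_altWord_eq m (by omega)
    ((matI m).toCoxeterSystem.wordProd (altWord i j (2 * m)))
  rcases ht.lt_or_eq with ht | rfl
  · exfalso
    have h1 := (squareFree_prod_altWord m hij' ht.le).2
    rw [← dihedralHom_wordProd m (by omega), ← hw, dihedralHom_wordProd,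
      (squareFree_prod_altWord m hij le_rfl).2, billiard_two_mul] at h1
    exact billiard_ne m hm (by omega) ht h1.symm
  · rw [CoxeterSystem.IsReduced, hw, hred.eq, length_altWord, length_altWord]

theorem length_dihedralHom (hm : 1 ≤ m) (w : (matI m).Group) (k : Fin 2)
    (h : (matI m).toCoxeterSystem.length w <
      (matI m).toCoxeterSystem.length ((matI m).simple k * w)) :
    (matB m).toCoxeterSystem.length (dihedralHom m hm ((matI m).simple k) * dihedralHom m hm w) =
      (matB m).toCoxeterSystem.length (dihedralHom m hm ((matI m).simple k)) +
        (matB m).toCoxeterSystem.length (dihedralHom m hm w) := by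
  obtain ⟨ω, hω, rfl⟩ := (matI m).toCoxeterSystem.exists_isReduced w
  have hred : (matI m).toCoxeterSystem.IsReduced (k :: ω) := by
    have h1 := (matI m).toCoxeterSystem.length_wordProd_le (k :: ω)
    rw [CoxeterSystem.wordProd_cons, CoxeterMatrix.toCoxeterSystem_simple,
      List.length_cons] at h1
    rw [hω.eq] at h
    rw [CoxeterSystem.IsReduced, CoxeterSystem.wordProd_cons,
      CoxeterMatrix.toCoxeterSystem_simple, List.length_cons]
    omega
  have key : ∀ ω, (matI m).toCoxeterSystem.IsReduced ω →
      (matB m).toCoxeterSystem.length (dihedralHom m hm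
        ((matI m).toCoxeterSystem.wordProd ω)) = length _ (ω.map (halfB m)).prod := by
    intro ω hω
    obtain ⟨i, j, t, hij, ht, rfl⟩ := exists_altWord_of_isReduced m hm hω
    rw [dihedralHom_wordProd, (squareFree_prod_altWord m hij ht).1]
  have h1 := key _ hred
  rw [CoxeterSystem.wordProd_cons, map_mul, CoxeterMatrix.toCoxeterSystem_simple, List.map_cons,
    List.prod_cons, length_mul, ← key ω hω] at h1
  rw [h1, dihedralHom_simple, squareFree_halfB m hm]

theorem dihedralHom_longest_univ (hm : 2 ≤ m) :
    dihedralHom m (by omega) (longest (matI m) Set.univ) = longest (matB m) Set.univ := by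
  obtain ⟨i, j, t, hij, ht, hred, hw⟩ := exists_altWord_eq m (by omega)
    (longest (matI m) Set.univ)
  have h1 := length_le_length_longest (finiteType_matI m (by omega) Set.univ)
    (u := (matI m).toCoxeterSystem.wordProd (altWord 0 1 (2 * m)))
    (by rw [parabolicSubgroup_univ]; trivial)
  rw [hw, hred.eq, (isReduced_altWord_matI m hm (by decide)).eq, length_altWord,
    length_altWord] at h1
  obtain rfl : t = 2 * m := by omega
  rw [hw, dihedralHom_wordProd]
  refine eq_of_repB_eq (dom_rhoB m) ?_
  rw [(squareFree_prod_altWord m hij le_rfl).2, billiard_two_mul, repB_longest_univ]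
  intro k hk
  simp [rhoB, hk]

theorem exists_dihedralHom_longest (hm : 2 ≤ m) (J' : Set (Fin 2)) :
    ∃ J, dihedralHom m (by omega) (longest (matI m) J') = longest (matB m) J := by
  have hs : ∀ i : Fin 2, ∃ J,
      dihedralHom m (by omega) (longest (matI m) {i}) = longest (matB m) J := by
    intro i
    rw [longest_singleton (finiteType_matI m (by omega) _), dihedralHom_simple, halfB]
    obtain ⟨h1, h2, -⟩ := stepDownB_spec _ (Nat.sub_le m i)
    refine ⟨_, eq_longest (dom_rhoB m) h1 fun a ha => ?_⟩
    simp only [Set.mem_ofPred_eq] at ha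
    change posB m a _
    simp only [posB, Pi.neg_apply, h2, rhoB]
    have := a.2
    split_ifs <;> omega
  by_cases h0 : (0 : Fin 2) ∈ J' <;> by_cases h1 : (1 : Fin 2) ∈ J'
  · obtain rfl : J' = Set.univ := by
      ext i; fin_cases i <;> simp [h0, h1]
    exact ⟨_, dihedralHom_longest_univ m hm⟩
  · obtain rfl : J' = {0} := by
      ext i; fin_cases i <;> simp [h0, h1]
    exact hs 0
  · obtain rfl : J' = {1} := by
      ext i; fin_cases i <;> simp [h0, h1]
    exact hs 1
  · obtain rfl : J' = ∅ := by
      ext i; fin_cases i <;> simp [h0, h1]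
    exact ⟨∅, by rw [longest_empty, longest_empty, map_one]⟩

theorem exists_dihedral_artinHom (hm : 2 ≤ m) :
    ∃ Φ : ArtinMonoid (matI m) →* ArtinMonoid (matB m),
      (∀ i, Φ (gen (matI m) i) = halfB m i) ∧
      Φ (lift (matI m) (longest (matI m) Set.univ)) =
        lift (matB m) (longest (matB m) Set.univ) ∧ MapsParabolic Φ := by
  obtain ⟨Φ, h1, h2⟩ := (domB m).exists_hom (dom_rhoB m) (dihedralHom m (by omega))
    (length_dihedralHom m (by omega)) (fun i j hij _ => by
      rw [matI_apply_of_ne m (by omega) hij]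
      exact isReduced_altWord_matI m hm hij)
  refine ⟨Φ, fun i => ?_, ?_, fun J' => ?_⟩
  · rw [h1, dihedralHom_simple]
    exact ((domB m).eq_lift (dom_rhoB m) (squareFree_halfB m (by omega) i)).symm
  · rw [h2, dihedralHom_longest_univ m hm]
  · obtain ⟨J, hJ⟩ := exists_dihedralHom_longest m hm J'
    exact ⟨J, by rw [parabolicElt, h2, map_mul, hJ, dihedralHom_longest_univ m hm, parabolicElt]⟩

end Bipartite

/-! ### The three families of homomorphisms -/

section Families

theorem squareFree_eq_lift {n : ℕ} {X : ArtinMonoid (matB n)} (h : SquareFree _ X) :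
    lift (matB n) (proj _ X) = X :=
  ((domB n).eq_lift (dom_rhoB n) h).symm

theorem lift_simple {n : ℕ} (i : Fin n) : lift (matB n) ((matB n).simple i) = gen (matB n) i :=
  squareFree_eq_lift (squareFree_gen i)

theorem exists_standard (m n : ℕ) (hm : 1 ≤ m) (hmn : m ≤ n) :
    ∃ Φ : ArtinMonoid (matB m) →* ArtinMonoid (matB n),
      (∀ i : ℕ, 1 ≤ i → i ≤ m - 1 → Φ (genB m i) = genB n i) ∧
      Φ (genB m m) = palindromeB n m ∧
      (∀ w, Φ (lift (matB m) w) =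
        lift (matB n) ((standardEmbedding m n hm hmn).groupHom w)) ∧ MapsParabolic Φ := by
  obtain ⟨Φ, h1, h2, h3⟩ := (standardEmbedding m n hm hmn).exists_artinHom
  refine ⟨Φ, fun i hi1 hi2 => ?_, ?_, h2, h3⟩
  · rw [genB_of_le hi1 (by omega), h1, genB_of_le hi1 (by omega), standardEmbedding]
    simp only
    rw [if_pos (by omega), lift_simple]
  · rw [genB_of_le hm le_rfl, h1, standardEmbedding]
    simp only
    rw [if_neg (by omega), squareFree_eq_lift (squareFree_palindromeB hm hmn)]

theorem homSupp_standard {m n : ℕ} (hm : 1 ≤ m) (hmn : m ≤ n) {B' : Type*}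
    {M' : CoxeterMatrix B'} {Φ : ArtinMonoid M' →* ArtinMonoid (matB n)} {X : ArtinMonoid M'}
    (hX : Φ X = lift (matB n)
      ((standardEmbedding m n hm hmn).groupHom (longest (matB m) Set.univ))) :
    homSupp Φ Set.univ = Set.univ := by
  have hle : ∀ k, -rhoB m k ≤ rhoB m k := fun k => by simp only [rhoB]; omega
  refine (standardEmbedding m n hm hmn).homSupp_eq_univ hX ?_ fun k => ?_
  · simp only [standardEmbedding, if_pos (show 0 < m by omega)]
    refine mul_lt_mul_of_pos_left ?_ (by omega)
    simp only [Pi.neg_apply, rhoB]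
    omega
  · simp only [standardEmbedding]
    split_ifs
    · exact mul_le_mul_of_nonneg_left (hle k) (by omega)
    · exact le_rfl
    · exact le_rfl

theorem map_stepDownB {m n : ℕ} (Φ : ArtinMonoid (matB m) →* ArtinMonoid (matB n))
    (h : ∀ i : ℕ, 1 ≤ i → i ≤ m - 1 → Φ (genB m i) = genB n i) (r : ℕ) (hr : r ≤ m - 1) :
    Φ (stepDownB m r) = stepDownB n r := by
  induction r using Nat.strong_induction_on with
  | _ r ih =>
    match r with
    | 0 => simp [stepDownB]
    | 1 => simp only [stepDownB]; exact h 1 le_rfl hr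
    | r + 2 =>
      simp only [stepDownB]
      rw [map_mul, h _ (by omega) hr, ih r (by omega) (by omega)]

theorem homSupp_cable {m n : ℕ} (hm : 1 ≤ m) (hn : 1 ≤ n)
    {Φ : ArtinMonoid (matB n) →* ArtinMonoid (matB (m * n))}
    (h : ∀ w, Φ (lift (matB n) w) = lift (matB (m * n)) ((cableEmbedding m n hm).groupHom w)) :
    homSupp Φ Set.univ = Set.univ := by
  have hm0 : (0 : ℤ) < 2 * m := by omega
  refine (cableEmbedding m n hm).homSupp_eq_univ (h _) ?_ fun k => ?_
  · change cableSeq m n _ 0 < cableSeq m n _ 0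
    have hpos : 0 < m * n := Nat.mul_pos hm hn
    simp only [cableSeq, if_pos hpos, Nat.zero_div]
    have : (2 * m : ℤ) * (-rhoB n) 0 < 2 * m * rhoB n 0 := by
      refine mul_lt_mul_of_pos_left ?_ hm0
      simp only [Pi.neg_apply, rhoB]
      omega
    omega
  · change cableSeq m n _ k ≤ cableSeq m n _ k
    simp only [cableSeq]
    split_ifs
    · have : (2 * m : ℤ) * (-rhoB n) (k / m) ≤ 2 * m * rhoB n (k / m) := by
        refine mul_le_mul_of_nonneg_left ?_ hm0.le
        simp only [Pi.neg_apply, rhoB]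
        omega
      omega
    · exact le_rfl

end Families

end Artin

end

theorem mainTheorem4 :
    (∀ m n : ℕ, 2 ≤ m → m ≤ n →
      ∃ Φ : Artin.ArtinMonoid (Artin.matI m) →* Artin.ArtinMonoid (Artin.matB n),
        Φ (Artin.gen (Artin.matI m) 0) = Artin.palindromeB n m * Artin.stepDownB n (m - 2) ∧
        Φ (Artin.gen (Artin.matI m) 1) = Artin.stepDownB n (m - 1) ∧
        Artin.StrictParabolic Φ ∧ Artin.MapsParabolicElts Φ) ∧
    (∀ m n : ℕ, 2 ≤ m → m ≤ n →
      ∃ Φ : Artin.ArtinMonoid (Artin.matB m) →* Artin.ArtinMonoid (Artin.matB n),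
        (∀ i : ℕ, 1 ≤ i → i ≤ m - 1 → Φ (Artin.genB m i) = Artin.genB n i) ∧
        Φ (Artin.genB m m) = Artin.palindromeB n m ∧
        Artin.StrictParabolic Φ ∧ Artin.MapsParabolicElts Φ) ∧
    (∀ m n : ℕ, 2 ≤ m → 2 ≤ n →
      ∃ Φ : Artin.ArtinMonoid (Artin.matB n) →* Artin.ArtinMonoid (Artin.matB (m * n)),
        (∀ i : ℕ, 1 ≤ i → i ≤ n - 1 → Φ (Artin.genB n i) =
          Artin.parabolicElt (Artin.matB (m * n))
            (Artin.intervalB (m * n) ((i - 1) * m + 1) (i * m - 1) ∪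
              Artin.intervalB (m * n) (i * m + 1) ((i + 1) * m - 1))
            (Artin.intervalB (m * n) ((i - 1) * m + 1) ((i + 1) * m - 1))) ∧
        Φ (Artin.genB n n) =
          Artin.parabolicElt (Artin.matB (m * n))
            (Artin.intervalB (m * n) ((n - 1) * m + 1) (n * m - 1))
            (Artin.intervalB (m * n) ((n - 1) * m + 1) (n * m)) ∧
        Artin.StrictParabolic Φ ∧ Artin.MapsParabolicElts Φ) := by
  refine ⟨fun m n hm hmn => ?_, fun m n hm hmn => ?_, fun m n hm hn => ?_⟩
  · -- compose the bipartite homomorphism into type `B_m` with the standard one into type `B_n`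
    obtain ⟨Ψ, h1, h2, h3⟩ := Artin.exists_dihedral_artinHom m hm
    obtain ⟨Φ, k1, k2, k3, k4⟩ := Artin.exists_standard m n (by omega) hmn
    refine ⟨Φ.comp Ψ, ?_, ?_, Artin.strictParabolic_of_mapsParabolic
      (Artin.finiteType_matI m (by omega) _)
      (Artin.homSupp_standard (by omega) hmn
        (X := Artin.lift _ (Artin.longest (Artin.matI m) Set.univ)) ?_) (k4.comp h3)⟩
    · obtain ⟨r, rfl⟩ : ∃ r, m = r + 2 := ⟨m - 2, by omega⟩
      rw [MonoidHom.comp_apply, h1, Artin.halfB]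
      change Φ (Artin.stepDownB (r + 2) (r + 2)) = _
      rw [Artin.stepDownB, map_mul, k2, Artin.map_stepDownB Φ k1 r (by omega), Nat.add_sub_cancel]
    · rw [MonoidHom.comp_apply, h1, Artin.halfB]
      exact Artin.map_stepDownB Φ k1 (m - 1) le_rfl
    · rw [MonoidHom.comp_apply, h2, k3]
  · obtain ⟨Φ, k1, k2, k3, k4⟩ := Artin.exists_standard m n (by omega) hmn
    exact ⟨Φ, k1, k2, Artin.strictParabolic_of_mapsParabolic (Artin.finiteType_matB _)
      (Artin.homSupp_standard (by omega) hmn (k3 _)) k4⟩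
  · obtain ⟨Φ, k1, k2, k3⟩ := (Artin.cableEmbedding m n (by omega)).exists_artinHom
    refine ⟨Φ, fun i hi1 hi2 => ?_, ?_, Artin.strictParabolic_of_mapsParabolic
      (Artin.finiteType_matB _) (Artin.homSupp_cable (by omega) (by omega) k2) k3⟩
    · obtain ⟨i, rfl⟩ : ∃ j, i = j + 1 := ⟨i - 1, by omega⟩
      rw [Artin.genB_of_le hi1 (by omega), k1]
      simp only [Artin.cableEmbedding, Artin.cableElt, Nat.add_sub_cancel]
      rw [if_pos (by omega), Artin.parabolicElt, show (i + 1) * m = i * m + m from Nat.succ_mul i m,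
        show (i + 1 + 1) * m = i * m + 2 * m by ring]
    · obtain ⟨n, rfl⟩ : ∃ j, n = j + 1 := ⟨n - 1, by omega⟩
      rw [Artin.genB_of_le (by omega) le_rfl, k1]
      simp only [Artin.cableEmbedding, Artin.cableElt, Nat.add_sub_cancel]
      rw [if_neg (by omega), Artin.parabolicElt, mul_comm (n + 1) m]
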